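/- Let $0<r_i<r_e$. For $0<\epsilon<r_e-r_i$ let $B_i$ and $B_e$ be the disks in $\mathbb{R}^2$ of radii $r_i$ and $r_e$ centered at $(c_i,0)$ and $(c_e,0)$, where $$c_i=\frac{r_e^2-r_i^2-(r_e-r_i-\epsilon)^2}{2(r_e-r_i-\epsilon)},\qquad c_e=c_i+r_e-r_i-\epsilon ,$$ so that $\overline{B_i}\subset B_e$ and $\mathrm{dist}(\partial B_i,\partial B_e)=\epsilon$. For $k_i,k_e>0$ let $\sigma=k_i\chi(B_i)+k_e\chi(B_e\setminus B_i)+\chi(\mathbb{R}^2\setminus B_e)$ and, when $k_i\ne k_e$ and $k_e\neq 1$, put $$\lambda_i=\frac{k_i+k_e}{2(k_i-k_e)},\qquad \lambda_e=\frac{k_e+1}{2(k_e-1)}.$$ For an entire harmonic function $H:\mathbb{R}^2\to\mathbb{R}$, let $u\in H^1_{\mathrm{loc}}(\mathbb{R}^2)$ be the weak solution of $$\nabla\cdot\sigma\nabla u=0\ \text{ in }\mathbb{R}^2,\qquad u(\mathbf{x})-H(\mathbf{x})=O(|\mathbf{x}|^{-1})\ \text{ as }|\mathbf{x}|\to\infty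 .$$ (a) For $k_i,k_e>0$ with $k_i\ne k_e$, $k_e\ne1$, one has $\lambda_i\lambda_e>\tfrac14$ if and only if either $k_i>k_e>1$ or $k_i<k_e<1$. (b) For every entire harmonic $H$ and every $\epsilon_0<r_e-r_i$ there is a constant $C>0$, depending only on $H,r_i,r_e,\epsilon_0$ (and in particular independent of $\epsilon$, $k_i$ and $k_e$), such that $$\|\nabla(u-H)\|_{L^\infty(\mathbb{R}^2)}\le C$$ for all $0<\epsilon\le\epsilon_0$ and all $k_i,k_e>0$ with $\lambda_i\lambda_e>\tfrac14$. -/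

import Mathlib

open MeasureTheory Filter
open scoped ContDiff ENNReal Gradient

noncomputable section

/-! The plane `ℝ²` is identified with `ℂ`, with its real inner product, Euclidean norm and
Lebesgue measure. -/

namespace CoreShell

/-- Abscissa of the centre of the core `B_i`, in the coordinates in which both centres lie on the
positive real axis and the two fixed points of the combined reflections across `∂B_i` and `∂B_e`
are symmetric about the origin. -/
def coreCenter (r_i r_e ε : ℝ) : ℝ :=
  (r_e ^ 2 - r_i ^ 2 - (r_e - r_i - ε) ^ 2) / (2 * (r_e - r_i - ε))

/-- Abscissa of the centre of the outer disk `B_e`. -/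
def shellCenter (r_i r_e ε : ℝ) : ℝ :=
  coreCenter r_i r_e ε + r_e - r_i - ε

/-- The core `B_i`. -/
def core (r_i r_e ε : ℝ) : Set ℂ :=
  Metric.ball (coreCenter r_i r_e ε : ℂ) r_i

/-- The disk `B_e`, i.e. the core together with the shell. -/
def outerDisk (r_i r_e ε : ℝ) : Set ℂ :=
  Metric.ball (shellCenter r_i r_e ε : ℂ) r_e

open scoped Classical in
/-- The conductivity: `k_i` in `B_i`, `k_e` in `B_e \ B_i`, and `1` outside `B_e`. -/
def conductivity (r_i r_e ε k_i k_e : ℝ) (x : ℂ) : ℝ :=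
  if x ∈ core r_i r_e ε then k_i else if x ∈ outerDisk r_i r_e ε then k_e else 1

/-- `λ_i = (k_i + k_e) / (2 (k_i - k_e))`. -/
def lambdaI (k_i k_e : ℝ) : ℝ := (k_i + k_e) / (2 * (k_i - k_e))

/-- `λ_e = (k_e + 1) / (2 (k_e - 1))`. -/
def lambdaE (k_e : ℝ) : ℝ := (k_e + 1) / (2 * (k_e - 1))

/-- `u` belongs to `H¹_loc(ℝ²)` and `G` is its weak gradient. -/
structure IsWeakGradient (u : ℂ → ℝ) (G : ℂ → ℂ) : Prop where
  memLp_fun : ∀ K : Set ℂ, IsCompact K → MemLp u 2 (volume.restrict K)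
  memLp_grad : ∀ K : Set ℂ, IsCompact K → MemLp G 2 (volume.restrict K)
  integral_eq : ∀ φ : ℂ → ℝ, ContDiff ℝ ∞ φ → HasCompactSupport φ →
    ∫ x, u x • ∇ φ x = -∫ x, φ x • G x

/-- `u`, with weak gradient `G`, solves the conductivity problem: `∇ · (σ ∇u) = 0` in `ℝ²` in the
weak sense, and `u(x) - H(x) = O(|x|⁻¹)` as `|x| → ∞`. -/
structure IsSolution (σ H u : ℂ → ℝ) (G : ℂ → ℂ) : Prop where
  weakGradient : IsWeakGradient u G
  equation : ∀ φ : ℂ → ℝ, ContDiff ℝ ∞ φ → HasCompactSupport φ →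
    ∫ x, σ x * inner ℝ (G x) (∇ φ x) = 0
  decay : (fun x => u x - H x) =O[cocompact ℂ] (fun x => ‖x‖⁻¹)

end CoreShell

end

/-!
Part (a) is algebra: `λ_i λ_e > 1/4` says that `k_i - k_e` and `k_e - 1` have the same sign.

For part (b), write `H = Re h` with `h` entire, and let `R_i`, `R_e` be the reflections across
`∂B_i`, `∂B_e`. The Möbius map `T = R_i ∘ R_e` has the fixed points `±p`, where
`p² = c_i² - r_i² = c_e² - r_e²`; in the coordinate `(z - p) / (z + p)` it is multiplication by some
`μ ∈ [0, 1]`, so that it belongs to the semigroup `flow p s` (`flow_flow`, `flow_circleRefl`).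
Matching both transmission conditions by images leads to the series
`A = α ∑ (-q)ⁿ h ∘ Tⁿ` with `α = 2 / (1 + k_e)` and `q = 1 / (4 λ_i λ_e) ∈ [0, 1)`.
With the `1`-Lipschitz maps `Φ_i`, `Φ_e` that fold the plane onto the closed disks (`diskFold`) the
solution is, up to a constant,
`u = Re (h + (A - h) ∘ Φ_e + β A ∘ Φ_i)`, where `β = (k_e - k_i) / (k_e + k_i)`.
Hence a Lipschitz constant of `A` on the closed disk `B_e` gives one of `u - H`.

As `ε → 0` the fixed points merge, and `∑ |(h ∘ Tⁿ)'|` is unbounded; it is the alternation of signs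
that saves the estimate. Summation by parts (`norm_sum_neg_pow_mul_le`) bounds the partial sums of
`A'` by the total variation of `s ↦ (h ∘ flow p s)'` on `[0, 1]`, and this variation is bounded
uniformly in `p` (`norm_deriv_comp_flow_sub_le`). The outcome is `exists_alternating_series`.

That `u` solves the problem weakly needs no Green identity on the disks. The function
`v = Im (h - (h - k_e A) ∘ Φ_e - k_e β A ∘ Φ_i)` is locally Lipschitz, and `∇v = i σ ∇u` off the two
circles (`gradient_conjugate_eq`), so `∫ σ ∇u · ∇φ` is the integral of `∇v` against the divergence
free field obtained by rotating `∇φ`, which vanishes (`integral_mul_inner_gradient_eq_zero`).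
Finally, every weak solution has the same gradient almost everywhere: the difference of two of them
is `O(|x|⁻¹)`, and Caccioppoli's inequality on growing disks kills its gradient
(`IsWeakGradient.ae_eq_zero`). Testing the equation with the cut off difference itself is justified
by mollification (`integral_inner_eq_zero_of_memLp`).
-/

namespace CoreShell

open scoped Topology Convolution

/-! ### Mollification in `L²` -/

section Mollification

open ContinuousLinearMap

/-- Translations are continuous in `L²`. -/
theorem tendsto_eLpNorm_translate_sub {E : Type*} [NormedAddCommGroup E]
    {g : ℂ → E} (hg : MemLp g 2 volume) :
    Tendsto (fun t : ℂ => eLpNorm (fun x => g (x - t) - g x) 2 volume) (𝓝 0) (𝓝 0) := by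
  have hm : ∀ t : ℂ, MeasurePreserving (ContinuousMap.mk (fun x : ℂ => x - t) (by fun_prop))
      volume volume := fun t => measurePreserving_sub_right volume t
  have hc : Continuous (fun t : ℂ => ContinuousMap.mk (fun x : ℂ => x - t) (by fun_prop)) :=
    (ContinuousMap.curry ⟨fun a : ℂ × ℂ => a.2 - a.1, by fun_prop⟩).continuous
  have h1 : Continuous (fun t : ℂ => Lp.compMeasurePreserving _ (hm t) (hg.toLp g)) :=
    Continuous.compMeasurePreservingLp continuous_const hc hm (by simp)
  have h2 := (h1.tendsto 0)
  have h3 := EMetric.tendsto_nhds.1 h2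
  rw [ENNReal.tendsto_nhds_zero]
  intro ε hε
  filter_upwards [h3 ε hε] with t ht
  have : edist (Lp.compMeasurePreserving _ (hm t) (hg.toLp g))
      (Lp.compMeasurePreserving _ (hm 0) (hg.toLp g)) =
      eLpNorm (fun x => g (x - t) - g x) 2 volume := by
    rw [Lp.toLp_compMeasurePreserving, Lp.toLp_compMeasurePreserving, Lp.edist_toLp_toLp]
    simp [Function.comp_def, Pi.sub_def]
  exact (this ▸ ht).le

/-- The `L²` distance of a mollification to the function is at most the largest `L²` distance to a
translate by a vector in the support of the mollifier. -/
theorem eLpNorm_normed_convolution_sub_le {E : Type*} [NormedAddCommGroup E] [NormedSpace ℝ E]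
    [CompleteSpace E]
    {g : ℂ → E} (hg : MemLp g 2 volume) (φ : ContDiffBump (0 : ℂ)) {η : ℝ≥0∞}
    (hη : ∀ t ∈ Metric.ball (0 : ℂ) φ.rOut, eLpNorm (fun x => g (x - t) - g x) 2 volume ≤ η) :
    eLpNorm (fun x => (φ.normed volume ⋆[lsmul ℝ ℝ, volume] g) x - g x) 2 volume ≤ η := by
  have hgm := hg.aestronglyMeasurable
  have hli : LocallyIntegrable g volume := hg.locallyIntegrable (by norm_num)
  set ρ : ℂ → ℝ≥0∞ := fun t => ENNReal.ofReal (φ.normed volume t) with hρ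
  have hρm : Measurable ρ := φ.continuous_normed.measurable.ennreal_ofReal
  set ν : Measure ℂ := volume.withDensity ρ with hν
  have hρ1 : ∫⁻ t, ρ t = 1 := by
    rw [hρ, ← ofReal_integral_eq_lintegral_ofReal φ.integrable_normed
      (ae_of_all _ φ.nonneg_normed), φ.integral_normed, ENNReal.ofReal_one]
  have hνp : IsProbabilityMeasure ν := ⟨by rw [hν, withDensity_apply _ MeasurableSet.univ]; simpa⟩
  have hρz : ∀ t, t ∉ Metric.ball (0 : ℂ) φ.rOut → ρ t = 0 := by
    intro t ht
    have : t ∉ Function.support (φ.normed volume) := by rwa [φ.support_normed_eq]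
    simp [hρ, Function.notMem_support.1 this]
  have hprod : AEStronglyMeasurable (fun z : ℂ × ℂ => g (z.1 - z.2) - g z.1)
      (volume.prod volume) := by
    refine AEStronglyMeasurable.sub ?_ ?_
    · exact hgm.comp_quasiMeasurePreserving (quasiMeasurePreserving_sub volume volume)
    · exact hgm.comp_fst
  have hprod2 : AEMeasurable (fun z : ℂ × ℂ => ρ z.2 * ‖g (z.1 - z.2) - g z.1‖ₑ ^ 2)
      (volume.prod volume) :=
    (hρm.comp measurable_snd).aemeasurable.mul (hprod.enorm.pow_const 2)
  have hsl : ∀ x : ℂ, AEStronglyMeasurable (fun t => g (x - t)) volume := fun x =>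
    hgm.comp_quasiMeasurePreserving (quasiMeasurePreserving_sub_left volume x)
  -- Jensen's inequality for the probability measure with density `ρ`
  have key : ∀ x, ‖(φ.normed volume ⋆[lsmul ℝ ℝ, volume] g) x - g x‖ₑ ^ 2 ≤
      ∫⁻ t, ρ t * ‖g (x - t) - g x‖ₑ ^ 2 := by
    intro x
    have e1 : (φ.normed volume ⋆[lsmul ℝ ℝ, volume] g) x - g x =
        ∫ t, φ.normed volume t • (g (x - t) - g x) := by
      simp only [smul_sub]
      rw [integral_sub, integral_smul_const, φ.integral_normed, one_smul]
      · rfl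
      · exact (φ.hasCompactSupport_normed.convolutionExists_left (lsmul ℝ ℝ)
          φ.continuous_normed hli x)
      · exact φ.integrable_normed.smul_const _
    have hF : AEMeasurable (fun t => ‖g (x - t) - g x‖ₑ) volume :=
      ((hsl x).sub aestronglyMeasurable_const).enorm
    have hac : ν ≪ volume := withDensity_absolutelyContinuous _ _
    have e2 : ‖(φ.normed volume ⋆[lsmul ℝ ℝ, volume] g) x - g x‖ₑ ≤
        ∫⁻ t, ‖g (x - t) - g x‖ₑ ∂ν := by
      rw [e1, hν, lintegral_withDensity_eq_lintegral_mul₀ hρm.aemeasurable hF]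
      refine (enorm_integral_le_lintegral_enorm _).trans (lintegral_mono fun t => ?_)
      simp only [Pi.mul_apply, enorm_smul, hρ]
      rw [Real.enorm_of_nonneg (φ.nonneg_normed t)]
    have e3 : (∫⁻ t, ‖g (x - t) - g x‖ₑ ∂ν) ^ 2 ≤ ∫⁻ t, ‖g (x - t) - g x‖ₑ ^ 2 ∂ν := by
      have := ENNReal.lintegral_mul_le_Lp_mul_Lq ν (p := 2) (q := 2) ⟨by norm_num, by norm_num, by norm_num⟩
        (hF.mono_ac hac) (aemeasurable_const (b := (1 : ℝ≥0∞)))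
      simp at this
      have h2 := pow_le_pow_left' this 2
      refine h2.trans ?_
      rw [← ENNReal.rpow_natCast, ← ENNReal.rpow_mul]
      simp
    refine (pow_le_pow_left' e2 2).trans (e3.trans ?_)
    rw [hν, lintegral_withDensity_eq_lintegral_mul₀ hρm.aemeasurable (hF.pow_const 2)]
    rfl
  have hsq : ∀ f : ℂ → E, eLpNorm f 2 volume ≤ η ↔ ∫⁻ x, ‖f x‖ₑ ^ 2 ≤ η ^ 2 := by
    intro f
    rw [eLpNorm_eq_lintegral_rpow_enorm_toReal (by simp) (by simp)]
    simp only [ENNReal.toReal_ofNat]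
    rw [one_div, ENNReal.rpow_inv_le_iff (by norm_num)]
    norm_cast
  rw [hsq]
  calc ∫⁻ x, ‖(φ.normed volume ⋆[lsmul ℝ ℝ, volume] g) x - g x‖ₑ ^ 2
      ≤ ∫⁻ x, ∫⁻ t, ρ t * ‖g (x - t) - g x‖ₑ ^ 2 := lintegral_mono key
    _ = ∫⁻ t, ∫⁻ x, ρ t * ‖g (x - t) - g x‖ₑ ^ 2 := lintegral_lintegral_swap hprod2
    _ ≤ ∫⁻ t, ρ t * η ^ 2 := by
        refine lintegral_mono fun t => ?_
        dsimp only
        by_cases ht : t ∈ Metric.ball (0 : ℂ) φ.rOut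
        · rw [lintegral_const_mul' _ _ (by simp [hρ])]
          gcongr
          exact (hsq _).1 (hη t ht)
        · simp [hρz t ht]
    _ = η ^ 2 := by rw [lintegral_mul_const _ hρm, hρ1, one_mul]

theorem contDiff_fderiv_apply {φ : ℂ → ℝ} (hφ : ContDiff ℝ ∞ φ) (v : ℂ) :
    ContDiff ℝ ∞ (fun x => fderiv ℝ φ x v) :=
  (hφ.fderiv_right (m := ∞) (by simp)).clm_apply contDiff_const

theorem continuous_gradient {φ : ℂ → ℝ} (hφ : ContDiff ℝ ∞ φ) : Continuous (∇ φ) :=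
  (LinearIsometryEquiv.continuous _).comp (hφ.continuous_fderiv (by simp))

theorem hasCompactSupport_gradient {φ : ℂ → ℝ} (hc : HasCompactSupport φ) :
    HasCompactSupport (∇ φ) :=
  (hc.fderiv ℝ).comp_left (g := (InnerProductSpace.toDual ℝ ℂ).symm) (map_zero _)

theorem tsupport_gradient_subset {φ : ℂ → ℝ} : tsupport (∇ φ) ⊆ tsupport φ := by
  refine (closure_mono ?_).trans (tsupport_fderiv_subset ℝ (f := φ))
  intro x hx h
  exact hx (by simp only [gradient, h, map_zero])

/-- Mollification commutes with the weak gradient. -/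
theorem gradient_normed_convolution {v : ℂ → ℝ} {V : ℂ → ℂ} (hv : LocallyIntegrable v volume)
    (hw : ∀ φ : ℂ → ℝ, ContDiff ℝ ∞ φ → HasCompactSupport φ →
      ∫ x, v x • ∇ φ x = -∫ x, φ x • V x) (φ : ContDiffBump (0 : ℂ)) (x : ℂ) :
    ∇ (φ.normed volume ⋆[lsmul ℝ ℝ, volume] v) x =
      (φ.normed volume ⋆[lsmul ℝ ℝ, volume] V) x := by
  have h1 := φ.hasCompactSupport_normed.hasFDerivAt_convolution_right (lsmul ℝ ℝ).flip hv
    (φ.contDiff_normed (n := 1) (μ := volume)) x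
  rw [convolution_flip] at h1
  have hψ : ContDiff ℝ ∞ (fun t => φ.normed volume (x - t)) :=
    φ.contDiff_normed.comp (contDiff_const.sub contDiff_id)
  have hψc : HasCompactSupport (fun t => φ.normed volume (x - t)) :=
    φ.hasCompactSupport_normed.comp_homeomorph (Homeomorph.subLeft x)
  have hgrad : ∀ t, ∇ (fun t => φ.normed volume (x - t)) t = - ∇ (φ.normed volume) (x - t) := by
    intro t
    simp only [gradient]
    rw [← map_neg]
    congr 1
    have : HasFDerivAt (fun t => φ.normed volume (x - t))
        ((fderiv ℝ (φ.normed volume) (x - t)).comp (-(ContinuousLinearMap.id ℝ ℂ))) t := by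
      have hd : HasFDerivAt (φ.normed volume) (fderiv ℝ (φ.normed volume) (x - t)) (x - t) :=
        ((φ.contDiff_normed (n := 1)).differentiable (by simp) _).hasFDerivAt
      exact hd.comp t ((hasFDerivAt_id (𝕜 := ℝ) t).const_sub x)
    rw [this.fderiv]
    ext; simp
  have h2 := hw _ hψ hψc
  simp only [hgrad, smul_neg, integral_neg, neg_inj] at h2
  rw [convolution_eq_swap]
  simp only [lsmul_apply]
  rw [← h2]
  refine ext_inner_left ℝ fun y => ?_
  have hint : Integrable (fun t => v t • ∇ (φ.normed volume) (x - t)) volume := by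
    have hc : HasCompactSupport (fun t => ∇ (φ.normed volume) (x - t)) :=
      (hasCompactSupport_gradient φ.hasCompactSupport_normed).comp_homeomorph
        (Homeomorph.subLeft x)
    have := hv.integrable_smul_right_of_hasCompactSupport
      ((continuous_gradient φ.contDiff_normed).comp (continuous_const.sub continuous_id)) hc
    exact this
  rw [real_inner_comm, inner_gradient_left, h1.fderiv, convolution_precompR_apply _ hv
    (φ.hasCompactSupport_normed.fderiv ℝ)
    ((φ.contDiff_normed (n := 1) (μ := volume)).continuous_fderiv (by simp)),
    ← integral_inner hint, convolution_def]
  refine integral_congr_ae (ae_of_all _ fun t => ?_)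
  simp only [ContinuousLinearMap.flip_apply, lsmul_apply, smul_eq_mul, inner_smul_right]
  rw [real_inner_comm, inner_gradient_left, mul_comm]

/-- A locally square integrable field orthogonal to the gradients of all test functions is also
orthogonal to compactly supported weak gradients in `L²`. -/
theorem integral_inner_eq_zero_of_memLp {F : ℂ → ℂ}
    (hF : ∀ K : Set ℂ, IsCompact K → MemLp F 2 (volume.restrict K))
    (hφ : ∀ φ : ℂ → ℝ, ContDiff ℝ ∞ φ → HasCompactSupport φ → ∫ x, inner ℝ (F x) (∇ φ x) = 0)
    {v : ℂ → ℝ} {V : ℂ → ℂ} (hv : MemLp v 2 volume) (hV : MemLp V 2 volume)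
    (hvs : HasCompactSupport v) (hVs : HasCompactSupport V)
    (hw : ∀ φ : ℂ → ℝ, ContDiff ℝ ∞ φ → HasCompactSupport φ →
      ∫ x, v x • ∇ φ x = -∫ x, φ x • V x) :
    ∫ x, inner ℝ (F x) (V x) = 0 := by
  -- `K` contains the supports of all mollifications of `v` at scales below `1`
  set K : Set ℂ := Metric.cthickening 1 (tsupport v) ∪ tsupport V with hKdef
  have hK : IsCompact K := (IsCompact.cthickening hvs).union hVs
  have hvl : LocallyIntegrable v volume := hv.locallyIntegrable (by norm_num)
  have hVl : LocallyIntegrable V volume := hV.locallyIntegrable (by norm_num)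
  set F' : ℂ → ℂ := K.indicator F with hF'def
  have hF' : MemLp F' 2 volume := (memLp_indicator_iff_restrict hK.measurableSet).2 (hF K hK)
  have hFF : ∀ U : ℂ → ℂ, (∀ x, x ∉ K → U x = 0) → ∀ x, inner ℝ (F x) (U x) = inner ℝ (F' x) (U x) := by
    intro U hU x
    by_cases hx : x ∈ K
    · simp [hF'def, hx]
    · simp [hU x hx]
  have hVK : ∀ x, x ∉ K → V x = 0 := fun x hx =>
    image_eq_zero_of_notMem_tsupport fun h => hx (Or.inr h)
  have key : ∀ η : ℝ≥0∞, 0 < η → ‖∫ x, inner ℝ (F x) (V x)‖ₑ ≤ eLpNorm F' 2 volume * η := by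
    intro η hη
    obtain ⟨δ, hδ, hδη⟩ := Metric.eventually_nhds_iff.1
      ((ENNReal.tendsto_nhds_zero.1 (tendsto_eLpNorm_translate_sub hV)) η hη)
    set r : ℝ := min δ 1
    have hr : 0 < r := lt_min hδ one_pos
    let φ : ContDiffBump (0 : ℂ) := ⟨r / 2, r, by positivity, by linarith⟩
    set w : ℂ → ℝ := φ.normed volume ⋆[lsmul ℝ ℝ, volume] v with hwdef
    have hg : ∇ w = φ.normed volume ⋆[lsmul ℝ ℝ, volume] V :=
      funext (gradient_normed_convolution hvl hw φ)
    have hwc : HasCompactSupport w := φ.hasCompactSupport_normed.convolution _ hvs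
    have hws : ContDiff ℝ ∞ w :=
      φ.hasCompactSupport_normed.contDiff_convolution_left _ φ.contDiff_normed hvl
    have hD := eLpNorm_normed_convolution_sub_le hV φ (η := η) (by
      intro t ht
      have : ‖t‖ < r := by simpa using ht
      exact hδη (by simpa using this.trans_le (min_le_left _ _)))
    rw [← hg] at hD
    have hwK : ∀ x, x ∉ K → ∇ w x = 0 := by
      intro x hx
      refine image_eq_zero_of_notMem_tsupport fun h => hx (Or.inl ?_)
      have h := tsupport_gradient_subset h
      have hsub : Function.support w ⊆ Metric.cthickening 1 (tsupport v) := by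
        refine (support_convolution_subset _).trans ?_
        rintro y ⟨a, ha, b, hb, rfl⟩
        rw [φ.support_normed_eq] at ha
        refine Metric.mem_cthickening_of_dist_le _ b _ _ (subset_tsupport _ hb) ?_
        have : ‖a‖ < r := by simpa using ha
        simpa using this.le.trans (min_le_right _ _)
      exact (closure_minimal hsub Metric.isClosed_cthickening) h
    have hgL : MemLp (∇ w) 2 volume :=
      (continuous_gradient hws).memLp_of_hasCompactSupport (hasCompactSupport_gradient hwc)
    have hint : ∀ U : ℂ → ℂ, MemLp U 2 volume → Integrable (fun x => inner ℝ (F' x) (U x)) volume := by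
      intro U hU
      have := L2.integrable_inner (𝕜 := ℝ) (hF'.toLp F') (hU.toLp U)
      refine this.congr ?_
      filter_upwards [hF'.coeFn_toLp, hU.coeFn_toLp] with x h1 h2
      rw [h1, h2]
    have e0 := hφ w hws hwc
    simp only [hFF _ hwK] at e0
    have e1 : ∫ x, inner ℝ (F x) (V x) = - ∫ x, inner ℝ (F' x) (∇ w x - V x) := by
      simp only [inner_sub_right]
      rw [integral_sub (hint _ hgL) (hint _ hV), e0]
      simp only [hFF _ hVK, zero_sub, neg_neg]
    rw [e1, enorm_neg]
    refine (enorm_integral_le_lintegral_enorm _).trans ?_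
    have hH := ENNReal.lintegral_mul_le_Lp_mul_Lq volume (p := 2) (q := 2)
      ⟨by norm_num, by norm_num, by norm_num⟩ hF'.1.enorm (hgL.sub hV).1.enorm
    calc ∫⁻ x, ‖inner ℝ (F' x) (∇ w x - V x)‖ₑ ≤ ∫⁻ x, ‖F' x‖ₑ * ‖∇ w x - V x‖ₑ := by
          refine lintegral_mono fun x => ?_
          rw [← ofReal_norm, ← ofReal_norm, ← ofReal_norm,
            ← ENNReal.ofReal_mul (norm_nonneg _)]
          exact ENNReal.ofReal_le_ofReal (norm_inner_le_norm _ _)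
      _ ≤ eLpNorm F' 2 volume * eLpNorm (fun x => ∇ w x - V x) 2 volume := by
          rw [eLpNorm_eq_lintegral_rpow_enorm_toReal (by simp) (by simp),
            eLpNorm_eq_lintegral_rpow_enorm_toReal (by simp) (by simp)]
          simpa using hH
      _ ≤ eLpNorm F' 2 volume * η := by gcongr
  have hlim : Tendsto (fun η : ℝ≥0∞ => eLpNorm F' 2 volume * η) (𝓝[>] 0) (𝓝 0) := by
    have := ENNReal.Tendsto.const_mul (a := eLpNorm F' 2 volume) (m := id) (f := 𝓝[>] (0 : ℝ≥0∞))
      (b := 0) (tendsto_id.mono_left nhdsWithin_le_nhds) (Or.inr hF'.eLpNorm_ne_top)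
    simpa using this
  have h0 := ge_of_tendsto hlim (eventually_mem_nhdsWithin.mono fun η hη => key η hη)
  simpa using h0
end Mollification

/-! ### Uniqueness -/

theorem memLp_continuous_smul {E : Type*} [NormedAddCommGroup E] [NormedSpace ℝ E]
    {f : ℂ → E} {g : ℂ → ℝ} {K : Set ℂ} (hK : IsCompact K)
    (hf : MemLp f 2 (volume.restrict K)) (hg : Continuous g) :
    MemLp (fun x => g x • f x) 2 (volume.restrict K) := by
  obtain ⟨c, hc⟩ := hK.exists_bound_of_continuousOn hg.continuousOn
  refine hf.of_le_mul (c := c) (hg.aestronglyMeasurable.smul hf.1) ?_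
  filter_upwards [ae_restrict_mem hK.measurableSet] with x hx
  rw [norm_smul]
  exact mul_le_mul_of_nonneg_right (hc x hx) (norm_nonneg _)

theorem memLp_smul_continuous {f : ℂ → ℝ} {g : ℂ → ℂ} {K : Set ℂ} (hK : IsCompact K)
    (hf : MemLp f 2 (volume.restrict K)) (hg : Continuous g) :
    MemLp (fun x => f x • g x) 2 (volume.restrict K) := by
  obtain ⟨c, hc⟩ := hK.exists_bound_of_continuousOn hg.continuousOn
  refine hf.of_le_mul (c := c) (hf.1.smul hg.aestronglyMeasurable) ?_
  filter_upwards [ae_restrict_mem hK.measurableSet] with x hx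
  rw [norm_smul, mul_comm]
  exact mul_le_mul_of_nonneg_right (hc x hx) (norm_nonneg _)

theorem memLp_of_forall_notMem_eq_zero {E : Type*} [NormedAddCommGroup E] {f : ℂ → E} {K : Set ℂ}
    (hK : IsCompact K) (hf : MemLp f 2 (volume.restrict K)) (h0 : ∀ x, x ∉ K → f x = 0) :
    MemLp f 2 volume := by
  have : K.indicator f = f := by
    rw [Set.indicator_eq_self]
    intro x hx
    by_contra h
    exact hx (h0 x h)
  rw [← this]
  exact (memLp_indicator_iff_restrict hK.measurableSet).2 hf

theorem locallyIntegrable_of_memLp {E : Type*} [NormedAddCommGroup E] {f : ℂ → E}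
    (hf : ∀ K : Set ℂ, IsCompact K → MemLp f 2 (volume.restrict K)) :
    LocallyIntegrable f volume := by
  rw [locallyIntegrable_iff]
  intro K hK
  have : IsFiniteMeasure (volume.restrict K) := ⟨by simpa using hK.measure_lt_top⟩
  exact (hf K hK).integrable (by norm_num)

theorem gradient_mul {f g : ℂ → ℝ} {x : ℂ} (hf : DifferentiableAt ℝ f x)
    (hg : DifferentiableAt ℝ g x) :
    ∇ (fun y => f y * g y) x = f x • ∇ g x + g x • ∇ f x := by
  simp only [gradient]
  rw [fderiv_fun_mul hf hg]
  simp

theorem IsWeakGradient.integrable_smul_gradient {w : ℂ → ℝ} {W : ℂ → ℂ} (h : IsWeakGradient w W)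
    {φ : ℂ → ℝ} (hφ : ContDiff ℝ ∞ φ) (hc : HasCompactSupport φ) :
    Integrable (fun x => w x • ∇ φ x) volume :=
  (locallyIntegrable_of_memLp h.memLp_fun).integrable_smul_right_of_hasCompactSupport
    (continuous_gradient hφ) (hasCompactSupport_gradient hc)

theorem IsWeakGradient.integrable_smul_grad {w : ℂ → ℝ} {W : ℂ → ℂ} (h : IsWeakGradient w W)
    {φ : ℂ → ℝ} (hφ : ContDiff ℝ ∞ φ) (hc : HasCompactSupport φ) :
    Integrable (fun x => φ x • W x) volume :=
  (locallyIntegrable_of_memLp h.memLp_grad).integrable_smul_left_of_hasCompactSupport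
    hφ.continuous hc

theorem IsWeakGradient.sub {u w : ℂ → ℝ} {U W : ℂ → ℂ} (hu : IsWeakGradient u U)
    (hw : IsWeakGradient w W) :
    IsWeakGradient (fun x => u x - w x) (fun x => U x - W x) where
  memLp_fun K hK := (hu.memLp_fun K hK).sub (hw.memLp_fun K hK)
  memLp_grad K hK := (hu.memLp_grad K hK).sub (hw.memLp_grad K hK)
  integral_eq φ hφ hc := by
    simp only [sub_smul, smul_sub]
    rw [integral_sub (hu.integrable_smul_gradient hφ hc) (hw.integrable_smul_gradient hφ hc),
      integral_sub (hu.integrable_smul_grad hφ hc) (hw.integrable_smul_grad hφ hc),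
      hu.integral_eq φ hφ hc, hw.integral_eq φ hφ hc]
    abel

/-- Product rule: `χ w` has the weak gradient `χ W + w ∇χ` when `χ` is smooth. -/
theorem IsWeakGradient.integral_cutoff {w : ℂ → ℝ} {W : ℂ → ℂ} (h : IsWeakGradient w W)
    {χ : ℂ → ℝ} (hχ : ContDiff ℝ ∞ χ) {φ : ℂ → ℝ} (hφ : ContDiff ℝ ∞ φ)
    (hc : HasCompactSupport φ) :
    ∫ x, (χ x * w x) • ∇ φ x = -∫ x, φ x • (χ x • W x + w x • ∇ χ x) := by
  have hcm : HasCompactSupport (fun x => χ x * φ x) := hc.mul_left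
  have hsm : ContDiff ℝ ∞ (fun x => χ x * φ x) := hχ.mul hφ
  have h1 := h.integral_eq _ hsm hcm
  have hg : ∀ x, ∇ (fun y => χ y * φ y) x = χ x • ∇ φ x + φ x • ∇ χ x := fun x =>
    gradient_mul (hχ.differentiable (by simp) x) (hφ.differentiable (by simp) x)
  simp only [hg, smul_add] at h1 ⊢
  have hwl := locallyIntegrable_of_memLp h.memLp_fun
  have c1 : HasCompactSupport (fun x => χ x • ∇ φ x) :=
    (hasCompactSupport_gradient hc).mono fun x hx h0 => hx (by simp only [h0, smul_zero])
  have c2 : HasCompactSupport (fun x => φ x • ∇ χ x) :=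
    hc.mono fun x hx h0 => hx (by simp only [h0, zero_smul])
  have k1 : Continuous (fun x => χ x • ∇ φ x) := hχ.continuous.smul (continuous_gradient hφ)
  have k2 : Continuous (fun x => φ x • ∇ χ x) := hφ.continuous.smul (continuous_gradient hχ)
  have i1 : Integrable (fun x => w x • χ x • ∇ φ x) volume :=
    hwl.integrable_smul_right_of_hasCompactSupport k1 c1
  have i2 : Integrable (fun x => w x • φ x • ∇ χ x) volume :=
    hwl.integrable_smul_right_of_hasCompactSupport k2 c2
  have i3 : Integrable (fun x => φ x • χ x • W x) volume := by
    refine (h.integrable_smul_grad hsm hcm).congr (ae_of_all _ fun x => ?_)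
    simp only [smul_smul, mul_comm]
  have i2' : Integrable (fun x => φ x • w x • ∇ χ x) volume :=
    i2.congr (ae_of_all _ fun x => by simp only [smul_smul, mul_comm])
  rw [integral_add i1 i2] at h1
  rw [integral_add i3 i2', neg_add]
  have e1 : ∫ x, (χ x * w x) • ∇ φ x = ∫ x, w x • χ x • ∇ φ x :=
    integral_congr_ae (ae_of_all _ fun x => by simp only [smul_smul, mul_comm])
  have e2 : ∫ x, φ x • w x • ∇ χ x = ∫ x, w x • φ x • ∇ χ x :=
    integral_congr_ae (ae_of_all _ fun x => by simp only [smul_smul, mul_comm])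
  have e3 : ∫ x, φ x • χ x • W x = ∫ x, (χ x * φ x) • W x :=
    integral_congr_ae (ae_of_all _ fun x => by simp only [smul_smul, mul_comm])
  rw [e1, e2, e3, ← h1]
  abel

/-- A smooth cutoff at scale `R`, with gradient of size `1 / R`. -/
theorem exists_cutoff : ∃ L : ℝ, 0 < L ∧ ∀ R : ℝ, 0 < R → ∃ η : ℂ → ℝ, ContDiff ℝ ∞ η ∧
    (∀ x ∈ Metric.ball (0 : ℂ) R, η x = 1) ∧
    (∀ x, x ∉ Metric.closedBall (0 : ℂ) (2 * R) → η x = 0) ∧ HasCompactSupport η ∧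
    (∀ x, ‖∇ η x‖ ≤ L / R) := by
  let φ : ContDiffBump (0 : ℂ) := ⟨1, 2, one_pos, by norm_num⟩
  have hφ : ContDiff ℝ ∞ φ := φ.contDiff
  obtain ⟨L, hL⟩ := (hasCompactSupport_gradient φ.hasCompactSupport).exists_bound_of_continuous
    (continuous_gradient hφ)
  refine ⟨max L 1, by positivity, fun R hR => ⟨fun x => φ (R⁻¹ • x),
    hφ.comp (contDiff_const_smul _), ?_, ?_, ?_, ?_⟩⟩
  · intro x hx
    refine φ.one_of_mem_closedBall ?_
    have : ‖x‖ < R := by simpa using hx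
    rw [mem_closedBall_zero_iff, norm_smul, norm_inv, Real.norm_of_nonneg hR.le]
    change R⁻¹ * ‖x‖ ≤ 1
    rw [inv_mul_le_iff₀ hR]; linarith
  · intro x hx
    refine φ.zero_of_le_dist ?_
    have : 2 * R < ‖x‖ := by simpa using hx
    rw [dist_zero_right, norm_smul, norm_inv, Real.norm_of_nonneg hR.le]
    change 2 ≤ R⁻¹ * ‖x‖
    rw [le_inv_mul_iff₀ hR]; linarith
  · exact φ.hasCompactSupport.comp_homeomorph (Homeomorph.smulOfNeZero R⁻¹ (by positivity))
  · intro x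
    have hd : HasFDerivAt φ (fderiv ℝ φ (R⁻¹ • x)) (R⁻¹ • x) :=
      (hφ.differentiable (by simp) _).hasFDerivAt
    have hd2 := hd.comp x ((hasFDerivAt_id (𝕜 := ℝ) x).const_smul R⁻¹)
    have e : ∇ (fun x => φ (R⁻¹ • x)) x = R⁻¹ • ∇ φ (R⁻¹ • x) := by
      simp only [gradient]
      have := hd2.fderiv
      simp only [Function.comp_def] at this
      rw [this]
      simp
    rw [e, norm_smul, norm_inv, Real.norm_of_nonneg hR.le, div_eq_inv_mul]
    gcongr
    exact (hL _).trans (le_max_left _ _)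
/-- Caccioppoli's inequality: the energy of `w` in a disk of radius `R` is bounded by the integral
of `w² |∇η|²` over the annulus where the cutoff `η` varies, and for `w = O(|x|⁻¹)` this is
`O(R⁻²)`. -/
theorem IsWeakGradient.exists_setIntegral_le {σ w : ℂ → ℝ} {W : ℂ → ℂ} (h : IsWeakGradient w W)
    (hσ : Measurable σ) {m M : ℝ} (hm : 0 < m) (hσm : ∀ x, m ≤ σ x) (hσM : ∀ x, σ x ≤ M)
    (heq : ∀ φ : ℂ → ℝ, ContDiff ℝ ∞ φ → HasCompactSupport φ →
      ∫ x, σ x * inner ℝ (W x) (∇ φ x) = 0)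
    (hdec : w =O[cocompact ℂ] (fun x => ‖x‖⁻¹)) :
    ∃ B R₀ : ℝ, ∀ R : ℝ, R₀ < R → 0 < R →
      ∫ x in Metric.ball (0 : ℂ) R, ‖W x‖ ^ 2 ≤ B / R ^ 2 := by
  obtain ⟨L, hL, hcut⟩ := exists_cutoff
  obtain ⟨C, hC0, hC⟩ := hdec.exists_pos
  rw [Asymptotics.IsBigOWith, ← Metric.cobounded_eq_cocompact, ← comap_norm_atTop] at hC
  obtain ⟨R₀, hR₀⟩ := eventually_atTop.1 (eventually_comap.1 hC)
  have hM : 0 < M := hm.trans_le ((hσm 0).trans (hσM 0))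
  refine ⟨2 / m * (2 * M * C ^ 2 * L ^ 2 * (4 * Real.pi)), R₀, fun R hRR hR => ?_⟩
  obtain ⟨η, hη, hη1, hη0, hηc, hηL⟩ := hcut R hR
  set K : Set ℂ := Metric.closedBall (0 : ℂ) (2 * R) with hKdef
  have hK : IsCompact K := isCompact_closedBall _ _
  have hη2 : ContDiff ℝ ∞ (fun x => η x * η x) := hη.mul hη
  have hgrad : ∀ x, ∇ (fun x => η x * η x) x = (2 * η x) • ∇ η x := fun x => by
    rw [gradient_mul (hη.differentiable (by simp) x) (hη.differentiable (by simp) x), ← add_smul,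
      two_mul]
  have hg1 : ∀ x ∈ Metric.ball (0 : ℂ) R, ∇ η x = 0 := by
    intro x hx
    have : η =ᶠ[𝓝 x] fun _ => 1 :=
      (Metric.isOpen_ball.eventually_mem hx).mono fun y hy => hη1 y hy
    rw [this.gradient_eq, gradient_fun_const]
  have hg0 : ∀ x, x ∉ K → ∇ η x = 0 := by
    intro x hx
    have : η =ᶠ[𝓝 x] fun _ => 0 :=
      (Metric.isClosed_closedBall.isOpen_compl.eventually_mem hx).mono fun y hy => hη0 y hy
    rw [this.gradient_eq, gradient_fun_const]
  set v : ℂ → ℝ := fun x => (η x * η x) * w x with hv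
  set V : ℂ → ℂ := fun x => (η x * η x) • W x + w x • ∇ (fun x => η x * η x) x with hV
  have hv0 : ∀ x, x ∉ K → v x = 0 := fun x hx => by simp [hv, hη0 x hx]
  have hV0 : ∀ x, x ∉ K → V x = 0 := fun x hx => by simp [hV, hgrad, hη0 x hx]
  have hFm : ∀ K : Set ℂ, IsCompact K → MemLp (fun x => σ x • W x) 2 (volume.restrict K) := by
    intro K hK
    refine (h.memLp_grad K hK).of_le_mul (c := M)
      (hσ.aestronglyMeasurable.smul (h.memLp_grad K hK).1) (ae_of_all _ fun x => ?_)
    rw [norm_smul, Real.norm_of_nonneg (hm.le.trans (hσm x))]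
    exact mul_le_mul_of_nonneg_right (hσM x) (norm_nonneg _)
  have hVK : MemLp V 2 (volume.restrict K) :=
    (memLp_continuous_smul hK (h.memLp_grad K hK) hη2.continuous).add
      (memLp_smul_continuous hK (h.memLp_fun K hK) (continuous_gradient hη2))
  have hVL : MemLp V 2 volume := memLp_of_forall_notMem_eq_zero hK hVK hV0
  have hvL : MemLp v 2 volume :=
    memLp_of_forall_notMem_eq_zero hK (memLp_continuous_smul hK (h.memLp_fun K hK) hη2.continuous) hv0
  have h0 : ∫ x, inner ℝ (σ x • W x) (V x) = 0 := by
    refine integral_inner_eq_zero_of_memLp hFm (fun φ hφ hc => ?_) hvL hVL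
      (HasCompactSupport.intro hK hv0) (HasCompactSupport.intro hK hV0)
      (fun φ hφ hc => h.integral_cutoff hη2 hφ hc)
    simpa only [real_inner_smul_left] using heq φ hφ hc
  have hint : Integrable (fun x => inner ℝ (σ x • W x) (V x)) volume := by
    have i1 : IntegrableOn (fun x => inner ℝ (σ x • W x) (V x)) K volume := by
      have := L2.integrable_inner (𝕜 := ℝ) ((hFm K hK).toLp _) (hVK.toLp _)
      refine this.congr ?_
      filter_upwards [(hFm K hK).coeFn_toLp, hVK.coeFn_toLp] with x h1 h2
      rw [h1, h2]
    refine (integrableOn_iff_integrable_of_support_subset fun x hx => ?_).1 i1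
    by_contra hxK
    exact hx (by simp [hV0 x hxK])
  set b : ℝ := 2 * M * (C / R) ^ 2 * (L / R) ^ 2 with hb
  have hb0 : 0 ≤ b := by positivity
  have hpt : ∀ x, (Metric.ball (0 : ℂ) R).indicator (fun x => m / 2 * ‖W x‖ ^ 2) x ≤
      inner ℝ (σ x • W x) (V x) + (K.indicator (fun _ => b) x) := by
    intro x
    have hσ0 : 0 ≤ σ x := hm.le.trans (hσm x)
    have e : inner ℝ (σ x • W x) (V x) =
        σ x * (η x ^ 2 * ‖W x‖ ^ 2 + 2 * η x * w x * inner ℝ (W x) (∇ η x)) := by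
      simp only [hV, hgrad, inner_add_right, real_inner_smul_left, inner_smul_right,
        real_inner_self_eq_norm_sq]
      ring
    by_cases hxK : x ∈ K
    · by_cases hxb : x ∈ Metric.ball (0 : ℂ) R
      · rw [Set.indicator_of_mem hxb, Set.indicator_of_mem hxK, e, hη1 x hxb, hg1 x hxb]
        simp only [inner_zero_right]
        have := mul_le_mul_of_nonneg_right (hσm x) (sq_nonneg ‖W x‖)
        nlinarith [sq_nonneg ‖W x‖, mul_nonneg hm.le (sq_nonneg ‖W x‖)]
      · rw [Set.indicator_of_notMem hxb, Set.indicator_of_mem hxK, e]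
        have hxR : R ≤ ‖x‖ := by simpa using hxb
        have hw : |w x| ≤ C / R := by
          have := hR₀ ‖x‖ (hRR.le.trans hxR) x rfl
          rw [norm_inv, norm_norm, Real.norm_eq_abs] at this
          refine this.trans ?_
          rw [div_eq_mul_inv]
          gcongr
        have hin : |inner ℝ (W x) (∇ η x)| ≤ ‖W x‖ * (L / R) :=
          (abs_real_inner_le_norm _ _).trans (by gcongr; exact hηL x)
        have hprod : |w x * inner ℝ (W x) (∇ η x)| ≤ (C / R) * (‖W x‖ * (L / R)) := by
          rw [abs_mul]; gcongr
        -- AM-GM absorbs the cross term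
        have h2 : 0 ≤ η x ^ 2 * ‖W x‖ ^ 2 + 2 * η x * w x * inner ℝ (W x) (∇ η x) +
            2 * (C / R) ^ 2 * (L / R) ^ 2 := by
          have h3 : -(2 * η x * w x * inner ℝ (W x) (∇ η x)) ≤
              2 * |η x| * ((C / R) * (‖W x‖ * (L / R))) := by
            refine (neg_le_abs _).trans ?_
            rw [show 2 * η x * w x * inner ℝ (W x) (∇ η x) =
              2 * η x * (w x * inner ℝ (W x) (∇ η x)) by ring, abs_mul, abs_mul, abs_two]
            gcongr
          have h4 := sq_nonneg (|η x| * ‖W x‖ - (C / R) * (L / R))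
          have h5 : |η x| ^ 2 = η x ^ 2 := sq_abs _
          nlinarith [sq_nonneg ((C / R) * (L / R))]
        have h6 := mul_nonneg hσ0 h2
        have h7 : σ x * (2 * (C / R) ^ 2 * (L / R) ^ 2) ≤ b := by
          rw [hb, show 2 * M * (C / R) ^ 2 * (L / R) ^ 2 = M * (2 * (C / R) ^ 2 * (L / R) ^ 2) by
            ring]
          exact mul_le_mul_of_nonneg_right (hσM x) (by positivity)
        linarith [h6, h7]
    · have hxb : x ∉ Metric.ball (0 : ℂ) R := fun hx => hxK
        (Metric.closedBall_subset_closedBall (by linarith) (Metric.ball_subset_closedBall hx))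
      rw [Set.indicator_of_notMem hxb, Set.indicator_of_notMem hxK, hV0 x hxK]
      simp
  have hWK : IntegrableOn (fun x => m / 2 * ‖W x‖ ^ 2) (Metric.ball (0 : ℂ) R) volume := by
    have := (memLp_two_iff_integrable_sq_norm (h.memLp_grad K hK).1).1 (h.memLp_grad K hK)
    refine Integrable.const_mul (IntegrableOn.mono_set this ?_) _
    exact Metric.ball_subset_closedBall.trans (Metric.closedBall_subset_closedBall (by linarith))
  have hbK : Integrable (K.indicator fun _ => b) volume :=
    (integrable_indicator_iff hK.measurableSet).2 (integrableOn_const hK.measure_lt_top.ne)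
  have hfin := integral_mono (hWK.integrable_indicator Metric.isOpen_ball.measurableSet)
    (hint.add hbK) hpt
  simp only [Pi.add_apply] at hfin
  rw [integral_add hint hbK, h0, zero_add, integral_indicator Metric.isOpen_ball.measurableSet,
    integral_const_mul, integral_indicator hK.measurableSet, setIntegral_const, smul_eq_mul,
    hKdef, measureReal_def, Complex.volume_closedBall] at hfin
  have hvol : (ENNReal.ofReal (2 * R) ^ 2 * (NNReal.pi : ℝ≥0∞)).toReal = 4 * R ^ 2 * Real.pi := by
    rw [ENNReal.toReal_mul, ENNReal.toReal_pow, ENNReal.toReal_ofReal (by positivity)]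
    simp; ring
  rw [hvol] at hfin
  have hm2 : 0 < m / 2 := by positivity
  rw [← le_div_iff₀' hm2] at hfin
  refine hfin.trans (le_of_eq ?_)
  rw [hb]
  field_simp

/-- A weak solution that is `O(|x|⁻¹)` at infinity has vanishing gradient. -/
theorem IsWeakGradient.ae_eq_zero {σ w : ℂ → ℝ} {W : ℂ → ℂ} (h : IsWeakGradient w W)
    (hσ : Measurable σ) {m M : ℝ} (hm : 0 < m) (hσm : ∀ x, m ≤ σ x) (hσM : ∀ x, σ x ≤ M)
    (heq : ∀ φ : ℂ → ℝ, ContDiff ℝ ∞ φ → HasCompactSupport φ →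
      ∫ x, σ x * inner ℝ (W x) (∇ φ x) = 0)
    (hdec : w =O[cocompact ℂ] (fun x => ‖x‖⁻¹)) : W =ᵐ[volume] 0 := by
  obtain ⟨B, R₀, hB⟩ := h.exists_setIntegral_le hσ hm hσm hσM heq hdec
  have hi : ∀ R : ℝ, IntegrableOn (fun x => ‖W x‖ ^ 2) (Metric.ball (0 : ℂ) R) volume := by
    intro R
    have hK := isCompact_closedBall (0 : ℂ) R
    have := (memLp_two_iff_integrable_sq_norm (h.memLp_grad _ hK).1).1 (h.memLp_grad _ hK)
    exact IntegrableOn.mono_set this Metric.ball_subset_closedBall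
  have hz : ∀ r : ℝ, ∫ x in Metric.ball (0 : ℂ) r, ‖W x‖ ^ 2 = 0 := by
    intro r
    refine le_antisymm ?_ (integral_nonneg fun x => by positivity)
    have hlim : Tendsto (fun R : ℝ => B / R ^ 2) atTop (𝓝 0) :=
      (tendsto_pow_atTop (by norm_num)).const_div_atTop _
    refine ge_of_tendsto hlim ?_
    filter_upwards [eventually_gt_atTop R₀, eventually_gt_atTop 0, eventually_ge_atTop r]
      with R h1 h2 h3
    refine le_trans ?_ (hB R h1 h2)
    exact setIntegral_mono_set (hi R) (ae_of_all _ fun x => by positivity)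
      (Metric.ball_subset_ball h3).eventuallyLE
  have hz2 : ∀ n : ℕ, ∀ᵐ x, x ∈ Metric.ball (0 : ℂ) n → W x = 0 := by
    intro n
    have := (setIntegral_eq_zero_iff_of_nonneg_ae (ae_of_all _ fun x => by positivity)
      (hi n)).1 (hz n)
    rw [EventuallyEq, ae_restrict_iff' Metric.isOpen_ball.measurableSet] at this
    filter_upwards [this] with x hx hxn
    simpa using hx hxn
  filter_upwards [ae_all_iff.2 hz2] with x hx
  obtain ⟨n, hn⟩ := exists_nat_gt ‖x‖
  exact hx n (by simpa using hn)

/-! ### Weak gradients of locally Lipschitz functions -/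

theorem gradient_re_im (f : ℂ → ℝ) (x : ℂ) :
    (∇ f x).re = fderiv ℝ f x 1 ∧ (∇ f x).im = fderiv ℝ f x Complex.I := by
  rw [← inner_gradient_left, ← inner_gradient_left, Complex.inner, Complex.inner]
  simp

theorem measurable_gradient (f : ℂ → ℝ) : Measurable (∇ f) :=
  (LinearIsometryEquiv.continuous _).measurable.comp (measurable_fderiv ℝ f)

theorem exists_lipschitzOnWith_closedBall {u : ℂ → ℝ} (hu : LocallyLipschitz u) (R : ℝ) :
    ∃ C, LipschitzOnWith C u (Metric.closedBall 0 R) :=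
  LocallyLipschitzOn.exists_lipschitzOnWith_of_compact (isCompact_closedBall _ _)
    (hu.locallyLipschitzOn)

theorem norm_gradient (f : ℂ → ℝ) (x : ℂ) : ‖∇ f x‖ = ‖fderiv ℝ f x‖ := by
  simp [gradient]

/-- Integration by parts for a locally Lipschitz function and a test function. -/
theorem integral_fderiv_mul_eq {u φ : ℂ → ℝ} (hu : LocallyLipschitz u) (hφ : ContDiff ℝ 1 φ)
    (hc : HasCompactSupport φ) (v : ℂ) :
    ∫ x, fderiv ℝ u x v * φ x = -∫ x, fderiv ℝ φ x v * u x := by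
  obtain ⟨R, hR⟩ := hc.isBounded.subset_ball (0 : ℂ)
  obtain ⟨C, hC⟩ := exists_lipschitzOnWith_closedBall hu R
  obtain ⟨f, hf, hfu⟩ := hC.extend_real
  obtain ⟨D, hD⟩ := hφ.lipschitzWith_of_hasCompactSupport hc one_ne_zero
  have key := LipschitzWith.integral_lineDeriv_mul_eq (μ := volume) hf hD hc v
  have e1 : ∫ x, fderiv ℝ u x v * φ x = ∫ x, lineDeriv ℝ f x v * φ x := by
    refine integral_congr_ae ?_
    filter_upwards [hf.ae_differentiableAt] with x hx
    by_cases hxs : x ∈ tsupport φ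
    · have : f =ᶠ[𝓝 x] u := (Metric.isOpen_ball.eventually_mem (hR hxs)).mono fun y hy =>
        (hfu (Metric.ball_subset_closedBall hy)).symm
      rw [hx.lineDeriv_eq_fderiv, this.fderiv_eq]
    · simp [image_eq_zero_of_notMem_tsupport hxs]
  have e2 : ∫ x, lineDeriv ℝ φ x (-v) * f x = -∫ x, fderiv ℝ φ x v * u x := by
    rw [← integral_neg]
    refine integral_congr_ae (ae_of_all _ fun x => ?_)
    simp only [(hφ.differentiable one_ne_zero x).lineDeriv_eq_fderiv, map_neg]
    by_cases hxs : x ∈ tsupport φ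
    · rw [hfu (Metric.ball_subset_closedBall (hR hxs))]; ring
    · have : fderiv ℝ φ x = 0 :=
        image_eq_zero_of_notMem_tsupport fun h => hxs (tsupport_fderiv_subset ℝ h)
      simp [this]
  rw [e1, key, e2]

theorem memLp_gradient {u : ℂ → ℝ} (hu : LocallyLipschitz u) {K : Set ℂ} (hK : IsCompact K) :
    MemLp (∇ u) 2 (volume.restrict K) := by
  obtain ⟨R, hR⟩ := hK.isBounded.subset_ball (0 : ℂ)
  obtain ⟨C, hC⟩ := exists_lipschitzOnWith_closedBall hu R
  have : IsFiniteMeasure (volume.restrict K) := ⟨by simpa using hK.measure_lt_top⟩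
  refine MemLp.of_bound (measurable_gradient u).aestronglyMeasurable C ?_
  filter_upwards [ae_restrict_mem hK.measurableSet] with x hx
  rw [norm_gradient]
  exact norm_fderiv_le_of_lipschitzOn ℝ
    (mem_of_superset (Metric.isOpen_ball.mem_nhds (hR hx)) Metric.ball_subset_closedBall) hC

theorem isWeakGradient_gradient {u : ℂ → ℝ} (hu : LocallyLipschitz u) :
    IsWeakGradient u (∇ u) where
  memLp_fun K hK := by
    have : IsFiniteMeasure (volume.restrict K) := ⟨by simpa using hK.measure_lt_top⟩
    obtain ⟨c, hc⟩ := hK.exists_bound_of_continuousOn hu.continuous.continuousOn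
    refine MemLp.of_bound hu.continuous.aestronglyMeasurable c ?_
    filter_upwards [ae_restrict_mem hK.measurableSet] with x hx using hc x hx
  memLp_grad K hK := memLp_gradient hu hK
  integral_eq φ hφ hc := by
    refine ext_inner_left ℝ fun y => ?_
    have hc' : HasCompactSupport (fun x => u x • ∇ φ x) :=
      (hasCompactSupport_gradient hc).mono fun x hx h0 => hx (by simp only [h0, smul_zero])
    have i1 : Integrable (fun x => u x • ∇ φ x) volume :=
      (hu.continuous.smul (continuous_gradient hφ)).integrable_of_hasCompactSupport hc'
    have i2 : Integrable (fun x => φ x • ∇ u x) volume :=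
      (locallyIntegrable_of_memLp fun K hK =>
        memLp_gradient hu hK).integrable_smul_left_of_hasCompactSupport hφ.continuous hc
    rw [inner_neg_right, ← integral_inner i1, ← integral_inner i2]
    have := integral_fderiv_mul_eq hu (hφ.of_le (mod_cast le_top)) hc y
    have e : ∀ (f : ℂ → ℝ) (c : ℝ) (x : ℂ), inner ℝ y (c • ∇ f x) = c * fderiv ℝ f x y := by
      intro f c x
      rw [inner_smul_right, real_inner_comm, inner_gradient_left]
    simp only [e]
    rw [eq_neg_iff_add_eq_zero, add_comm, ← eq_neg_iff_add_eq_zero]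
    simpa only [mul_comm] using this

/-- If `σ ∇u` is the rotated gradient of a locally Lipschitz conjugate function `v`, then
`∇ · (σ ∇u) = 0` weakly, because `∇φ` rotated by a right angle is divergence free. -/
theorem integral_mul_inner_gradient_eq_zero {u v σ : ℂ → ℝ} (hv : LocallyLipschitz v)
    (h : ∀ᵐ x, ∇ v x = Complex.I * (σ x • ∇ u x)) {φ : ℂ → ℝ} (hφ : ContDiff ℝ ∞ φ)
    (hc : HasCompactSupport φ) : ∫ x, σ x * inner ℝ (∇ u x) (∇ φ x) = 0 := by
  have hφd : ∀ y : ℂ, ContDiff ℝ 1 (fun x => fderiv ℝ φ x y) := fun y =>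
    (contDiff_fderiv_apply hφ y).of_le (mod_cast le_top)
  have hφc : ∀ y : ℂ, HasCompactSupport (fun x => fderiv ℝ φ x y) := fun y =>
    (hc.fderiv ℝ).comp_left (g := fun L : ℂ →L[ℝ] ℝ => L y) (by simp)
  have hvi : ∀ y : ℂ, LocallyIntegrable (fun x => fderiv ℝ v x y) volume := by
    intro y
    refine locallyIntegrable_of_memLp fun K hK => ?_
    refine ((memLp_gradient hv hK).inner_const (𝕜 := ℝ) y).congr_norm ?_ ?_
    · exact (measurable_fderiv_apply_const ℝ v y).aestronglyMeasurable
    · exact ae_of_all _ fun x => by simp only [inner_gradient_left]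
  have hi : ∀ y z : ℂ, Integrable (fun x => fderiv ℝ v x y * fderiv ℝ φ x z) volume := fun y z =>
    (hvi y).integrable_smul_right_of_hasCompactSupport (hφd z).continuous (hφc z)
  have e : ∫ x, σ x * inner ℝ (∇ u x) (∇ φ x) =
      ∫ x, (fderiv ℝ v x Complex.I * fderiv ℝ φ x 1 - fderiv ℝ v x 1 * fderiv ℝ φ x Complex.I) := by
    refine integral_congr_ae ?_
    filter_upwards [h] with x hx
    obtain ⟨h1, h2⟩ := gradient_re_im v x
    obtain ⟨h3, h4⟩ := gradient_re_im φ x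
    rw [← h1, ← h2, ← h3, ← h4, hx, Complex.inner]
    simp
    ring
  rw [e, integral_sub (hi _ _) (hi _ _), integral_fderiv_mul_eq hv (hφd 1) (hφc 1),
    integral_fderiv_mul_eq hv (hφd _) (hφc _), sub_eq_zero]
  congr 1
  refine integral_congr_ae (ae_of_all _ fun x => ?_)
  have hs : IsSymmSndFDerivAt ℝ φ x := hφ.contDiffAt.isSymmSndFDerivAt (by simpa using ENat.LEInfty.out)
  have hd : DifferentiableAt ℝ (fderiv ℝ φ) x :=
    (hφ.fderiv_right (m := ∞) (by simp)).differentiable (by simp) x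
  have hd2 : ∀ y z : ℂ, fderiv ℝ (fun x => fderiv ℝ φ x y) x z = fderiv ℝ (fderiv ℝ φ) x z y := by
    intro y z
    rw [fderiv_clm_apply hd (by fun_prop)]
    simp
  simp only [hd2]
  rw [hs.eq]

/-! ### The hyperbolic flow between the fixed points `±p` -/

/-- The Möbius transformation `z ↦ w` with `(w - p) / (w + p) = s (z - p) / (z + p)`. The formula
stays meaningful at the fixed point `z = -p`; for real `0 < p` and `0 ≤ s ≤ 1` it has no pole in the
closed right half plane. -/
noncomputable def flow (p s z : ℂ) : ℂ :=
  p * ((1 + s) * z + (1 - s) * p) / ((1 - s) * z + (1 + s) * p)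

theorem norm_le_norm_flow_den {p s : ℝ} (hp : 0 < p) (hs0 : 0 ≤ s) (hs1 : s ≤ 1) {z : ℂ}
    (hz : 0 ≤ z.re) : p ≤ ‖(1 - s) * z + (1 + s) * (p : ℂ)‖ := by
  refine le_trans ?_ (Complex.re_le_norm _)
  have : ((1 - s) * z + (1 + s) * (p : ℂ)).re = (1 - s) * z.re + (1 + s) * p := by
    simp
  rw [this]
  nlinarith [mul_nonneg (sub_nonneg.2 hs1) hz]

theorem mul_norm_le_norm_flow_den {p s : ℝ} (hp : 0 < p) (hs0 : 0 ≤ s) (hs1 : s ≤ 1) {z : ℂ}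
    (hz : 0 ≤ z.re) : (1 - s) * ‖z‖ ≤ ‖(1 - s) * z + (1 + s) * (p : ℂ)‖ := by
  have h1 : 0 ≤ 1 - s := sub_nonneg.2 hs1
  refine le_of_sq_le_sq ?_ (norm_nonneg _)
  rw [mul_pow, ← Complex.normSq_eq_norm_sq, ← Complex.normSq_eq_norm_sq, Complex.normSq_apply,
    Complex.normSq_apply]
  simp
  nlinarith [mul_nonneg (mul_nonneg h1 hz) (mul_nonneg (by linarith : 0 ≤ 1 + s) hp.le),
    sq_nonneg ((1 + s) * p)]

theorem flow_den_ne_zero {p s : ℝ} (hp : 0 < p) (hs0 : 0 ≤ s) (hs1 : s ≤ 1) {z : ℂ}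
    (hz : 0 ≤ z.re) : (1 - s) * z + (1 + s) * (p : ℂ) ≠ 0 :=
  norm_pos_iff.1 (hp.trans_le (norm_le_norm_flow_den hp hs0 hs1 hz))

theorem flow_one {p : ℂ} (hp : p ≠ 0) (z : ℂ) : flow p 1 z = z := by
  simp only [flow]; field_simp; ring

theorem flow_flow {p s t : ℝ} (hp : 0 < p) (hs0 : 0 ≤ s) (hs1 : s ≤ 1) (ht0 : 0 ≤ t) (ht1 : t ≤ 1)
    {z : ℂ} (hz : 0 ≤ z.re) : flow p s (flow p t z) = flow p ((s * t : ℝ) : ℂ) z := by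
  have h1 := flow_den_ne_zero hp ht0 ht1 hz
  have h2 := flow_den_ne_zero hp (mul_nonneg hs0 ht0) (mul_le_one₀ hs1 ht0 ht1) hz
  have hp' : (p : ℂ) ≠ 0 := by exact_mod_cast hp.ne'
  push_cast at h2 ⊢
  have h3 : (1 - s) * flow p t z + (1 + s) * (p : ℂ) =
      2 * p * ((1 - s * t) * z + (1 + s * t) * p) / ((1 - t) * z + (1 + t) * p) := by
    rw [flow, mul_div_assoc', div_add' _ _ _ h1]; congr 1; ring
  have h4 : (1 + s) * flow p t z + (1 - s) * (p : ℂ) =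
      2 * p * ((1 + s * t) * z + (1 - s * t) * p) / ((1 - t) * z + (1 + t) * p) := by
    rw [flow, mul_div_assoc', div_add' _ _ _ h1]; congr 1; ring
  rw [flow, h3, h4, flow, mul_div_assoc', div_div_div_cancel_right₀ h1,
    show (p : ℂ) * (2 * p * ((1 + s * t) * z + (1 - s * t) * p)) =
      (2 * p) * (p * ((1 + s * t) * z + (1 - s * t) * p)) by ring,
    mul_div_mul_left _ _ (mul_ne_zero two_ne_zero hp')]

/-- Equation of a disk in terms of `p`, the limit point of its pencil. -/
theorem mem_closedBall_iff {c r p : ℝ} (hr : 0 ≤ r) (hp : p ^ 2 = c ^ 2 - r ^ 2) {z : ℂ} :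
    z ∈ Metric.closedBall (c : ℂ) r ↔ Complex.normSq z + p ^ 2 ≤ 2 * c * z.re := by
  rw [mem_closedBall_iff_norm, ← sq_le_sq₀ (norm_nonneg _) hr, ← Complex.normSq_eq_norm_sq,
    Complex.normSq_apply, Complex.normSq_apply, hp]
  simp
  constructor <;> intro h <;> nlinarith

theorem re_pos_of_mem_closedBall {c r : ℝ} (hrc : r < c) {z : ℂ}
    (hz : z ∈ Metric.closedBall (c : ℂ) r) : 0 < z.re := by
  have h1 := (Complex.abs_re_le_norm _).trans (mem_closedBall_iff_norm.1 hz)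
  simp at h1
  linarith [(abs_le.1 h1).1]

/-- The flow maps every disk of the pencil with limit points `±p` into itself. -/
theorem flow_mem_closedBall {c r p s : ℝ} (hr : 0 ≤ r) (hrc : r < c) (hp0 : 0 < p)
    (hp : p ^ 2 = c ^ 2 - r ^ 2) (hs0 : 0 ≤ s) (hs1 : s ≤ 1) {z : ℂ}
    (hz : z ∈ Metric.closedBall (c : ℂ) r) : flow p s z ∈ Metric.closedBall (c : ℂ) r := by
  have hx := re_pos_of_mem_closedBall hrc hz
  have hd := flow_den_ne_zero hp0 hs0 hs1 hx.le
  have hpc : p ≤ c := by nlinarith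
  rw [mem_closedBall_iff hr hp] at hz ⊢
  set d : ℂ := (1 - s) * z + (1 + s) * (p : ℂ) with hdd
  set n : ℂ := (1 + s) * z + (1 - s) * (p : ℂ) with hnn
  have hN : 0 < Complex.normSq d := Complex.normSq_pos.2 hd
  have e1 : Complex.normSq (flow p s z) = p ^ 2 * Complex.normSq n / Complex.normSq d := by
    rw [flow, ← hdd, ← hnn, Complex.normSq_div, Complex.normSq_mul, Complex.normSq_ofReal]; ring
  have e2 : (flow p s z).re = p * (n.re * d.re + n.im * d.im) / Complex.normSq d := by
    rw [flow, ← hdd, ← hnn, Complex.div_re]; simp; field_simp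
  rw [e1, e2, ← mul_div_assoc, ← sub_nonneg]
  have e3 : 2 * c * (p * (n.re * d.re + n.im * d.im)) / Complex.normSq d -
      (p ^ 2 * Complex.normSq n / Complex.normSq d + p ^ 2) =
      (2 * c * (p * (n.re * d.re + n.im * d.im)) - p ^ 2 * (Complex.normSq n + Complex.normSq d)) /
        Complex.normSq d := by
    field_simp
  rw [e3]
  refine div_nonneg ?_ hN.le
  rw [Complex.normSq_apply] at hz
  have dre : d.re = (1 - s) * z.re + (1 + s) * p := by simp [hdd]
  have dim : d.im = (1 - s) * z.im := by simp [hdd]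
  have nre : n.re = (1 + s) * z.re + (1 - s) * p := by simp [hnn]
  have nim : n.im = (1 + s) * z.im := by simp [hnn]
  rw [Complex.normSq_apply, Complex.normSq_apply, dre, dim, nre, nim]
  set Q : ℝ := z.re * z.re + z.im * z.im + p ^ 2 with hQ
  have hQ2 : 2 * p * z.re ≤ Q := by nlinarith [sq_nonneg (z.re - p), mul_self_nonneg z.im]
  have hs2 : 0 ≤ 1 - s ^ 2 := by nlinarith
  have f1 : 0 ≤ 2 * p * (1 + s ^ 2) * p * (2 * c * z.re - Q) :=
    mul_nonneg (by positivity) (by linarith)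
  have f2 : 0 ≤ 2 * (1 - s ^ 2) * p * (c * Q - 2 * p ^ 2 * z.re) := by
    refine mul_nonneg (by positivity) ?_
    nlinarith [mul_le_mul_of_nonneg_right hpc hx.le,
      mul_nonneg hp0.le hx.le, mul_le_mul_of_nonneg_left hQ2 (hp0.le.trans hpc)]
  nlinarith

theorem hasDerivAt_flow {p s : ℝ} (hp : 0 < p) (hs0 : 0 ≤ s) (hs1 : s ≤ 1) {z : ℂ}
    (hz : 0 ≤ z.re) :
    HasDerivAt (flow p s) (4 * p ^ 2 * s / ((1 - s) * z + (1 + s) * p) ^ 2) z := by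
  have hd := flow_den_ne_zero hp hs0 hs1 hz
  have h1 : HasDerivAt (fun z : ℂ => (p : ℂ) * ((1 + s) * z + (1 - s) * p)) (p * ((1 + s) * 1)) z :=
    (((hasDerivAt_id z).const_mul _).add_const _).const_mul _
  have h2 : HasDerivAt (fun z : ℂ => (1 - s) * z + (1 + s) * (p : ℂ)) ((1 - s) * 1) z :=
    ((hasDerivAt_id z).const_mul _).add_const _
  convert! h1.div h2 hd using 1
  field_simp
  ring

/-- Velocity of the flow in the parameter `s`. -/
theorem hasDerivAt_flow_param {p s : ℝ} (hp : 0 < p) (hs0 : 0 ≤ s) (hs1 : s ≤ 1) {z : ℂ}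
    (hz : 0 ≤ z.re) :
    HasDerivAt (fun s : ℂ => flow p s z)
      (2 * p * (z - p) * (z + p) / ((1 - s) * z + (1 + s) * p) ^ 2) s := by
  have hd := flow_den_ne_zero hp hs0 hs1 hz
  have h1 : HasDerivAt (fun s : ℂ => (p : ℂ) * ((1 + s) * z + (1 - s) * p)) (p * (z - p)) (s : ℂ) := by
    convert! (((((hasDerivAt_id (s : ℂ)).const_add 1).mul_const z).add
      (((hasDerivAt_id (s : ℂ)).const_sub 1).mul_const (p : ℂ))).const_mul (p : ℂ)) using 1
    ring
  have h2 : HasDerivAt (fun s : ℂ => (1 - s) * z + (1 + s) * (p : ℂ)) (p - z) (s : ℂ) := by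
    convert! (((hasDerivAt_id (s : ℂ)).const_sub 1).mul_const z).add
      (((hasDerivAt_id (s : ℂ)).const_add 1).mul_const (p : ℂ)) using 1
    ring
  convert! h1.div h2 hd using 1
  field_simp
  ring

/-- Derivative in `s` of the stretching factor `∂_z flow`. -/
theorem hasDerivAt_flow_stretch {p s : ℝ} (hp : 0 < p) (hs0 : 0 ≤ s) (hs1 : s ≤ 1) {z : ℂ}
    (hz : 0 ≤ z.re) :
    HasDerivAt (fun s : ℂ => 4 * (p : ℂ) ^ 2 * s / ((1 - s) * z + (1 + s) * p) ^ 2)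
      (4 * p ^ 2 * ((z + p) + s * (z - p)) / ((1 - s) * z + (1 + s) * p) ^ 3) s := by
  have hd := flow_den_ne_zero hp hs0 hs1 hz
  have h1 : HasDerivAt (fun s : ℂ => 4 * (p : ℂ) ^ 2 * s) (4 * (p : ℂ) ^ 2 * 1) (s : ℂ) :=
    (hasDerivAt_id (s : ℂ)).const_mul _
  have h2 : HasDerivAt (fun s : ℂ => (1 - s) * z + (1 + s) * (p : ℂ)) (p - z) (s : ℂ) := by
    convert! (((hasDerivAt_id (s : ℂ)).const_sub 1).mul_const z).add
      (((hasDerivAt_id (s : ℂ)).const_add 1).mul_const (p : ℂ)) using 1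
    ring
  convert! h1.div (h2.pow 2) (pow_ne_zero 2 hd) using 1
  simp only [Pi.pow_apply]
  rw [← pow_mul, div_eq_div_iff (pow_ne_zero _ hd) (pow_ne_zero _ hd)]
  push_cast
  ring
/-! ### The alternating series of reflected potentials -/

theorem norm_sub_le_of_norm_deriv_le {F F' : ℝ → ℂ} {g g' : ℝ → ℝ}
    (hF : ∀ s ∈ Set.Icc (0 : ℝ) 1, HasDerivAt F (F' s) s)
    (hg : ∀ s ∈ Set.Icc (0 : ℝ) 1, HasDerivAt g (g' s) s)
    (hle : ∀ s ∈ Set.Icc (0 : ℝ) 1, ‖F' s‖ ≤ g' s) {a b : ℝ} (ha : 0 ≤ a) (hab : a ≤ b)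
    (hb : b ≤ 1) : ‖F b - F a‖ ≤ g b - g a := by
  have hmem : ∀ s ∈ Set.Icc a b, s ∈ Set.Icc (0 : ℝ) 1 := fun s hs =>
    ⟨ha.trans hs.1, hs.2.trans hb⟩
  refine image_norm_le_of_norm_deriv_right_le_deriv_boundary' (f := fun s => F s - F a) (f' := F')
    (B := fun s => g s - g a) (B' := g') (a := a) (b := b) ?_ ?_ (by simp) ?_ ?_ ?_
    (Set.right_mem_Icc.2 hab)
  · exact fun s hs => ((hF s (hmem s hs)).sub_const _).continuousAt.continuousWithinAt
  · exact fun s hs => ((hF s (hmem s (Set.Ico_subset_Icc_self hs))).sub_const _).hasDerivWithinAt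
  · exact fun s hs => ((hg s (hmem s hs)).sub_const _).continuousAt.continuousWithinAt
  · exact fun s hs => ((hg s (hmem s (Set.Ico_subset_Icc_self hs))).sub_const _).hasDerivWithinAt
  · exact fun s hs => hle s (hmem s (Set.Ico_subset_Icc_self hs))

/-- Summation by parts: alternating geometric weights turn a bound on the variation of `a` into a
bound on the sum which does not depend on `q`. -/
theorem norm_sum_neg_pow_mul_le {a : ℕ → ℂ} {G : ℕ → ℝ} {q M : ℝ} (hq0 : 0 ≤ q) (hq1 : q ≤ 1)
    (ha : ∀ n, ‖a n‖ ≤ M) (hG : ∀ n, ‖a n - a (n + 1)‖ ≤ G n - G (n + 1)) (hG0 : ∀ n, 0 ≤ G n)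
    (N : ℕ) : ‖∑ n ∈ Finset.range N, (-(q : ℂ)) ^ n * a n‖ ≤ 2 * M + G 0 := by
  have hqn : ∀ n, ‖(-(q : ℂ)) ^ n‖ ≤ 1 := fun n => by
    rw [norm_pow, norm_neg, Complex.norm_real, Real.norm_of_nonneg hq0]
    exact pow_le_one₀ hq0 hq1
  have id : ∀ N : ℕ, (1 + (q : ℂ)) * ∑ n ∈ Finset.range N, (-(q : ℂ)) ^ n * a n =
      a 0 - (-(q : ℂ)) ^ N * a N +
        ∑ n ∈ Finset.range N, (-(q : ℂ)) ^ (n + 1) * (a (n + 1) - a n) := by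
    intro N
    induction N with
    | zero => simp
    | succ N ih =>
      rw [Finset.sum_range_succ, mul_add, ih, Finset.sum_range_succ]
      ring
  have h1 : ‖(1 + (q : ℂ)) * ∑ n ∈ Finset.range N, (-(q : ℂ)) ^ n * a n‖ ≤ 2 * M + G 0 := by
    rw [id]
    have t1 : ‖(-(q : ℂ)) ^ N * a N‖ ≤ M := by
      rw [norm_mul]
      exact (mul_le_of_le_one_left (norm_nonneg _) (hqn N)).trans (ha N)
    have t2 : ‖∑ n ∈ Finset.range N, (-(q : ℂ)) ^ (n + 1) * (a (n + 1) - a n)‖ ≤ G 0 - G N := by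
      refine (norm_sum_le _ _).trans ?_
      rw [← Finset.sum_range_sub' G N]
      refine Finset.sum_le_sum fun n _ => ?_
      rw [norm_mul, norm_sub_rev]
      exact (mul_le_of_le_one_left (norm_nonneg _) (hqn _)).trans (hG n)
    have t3 := norm_add_le (a 0 - (-(q : ℂ)) ^ N * a N)
      (∑ n ∈ Finset.range N, (-(q : ℂ)) ^ (n + 1) * (a (n + 1) - a n))
    have t4 := norm_sub_le (a 0) ((-(q : ℂ)) ^ N * a N)
    linarith [ha 0, hG0 N]
  refine le_trans ?_ h1
  rw [norm_mul]
  refine le_mul_of_one_le_left (norm_nonneg _) ?_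
  have : (1 + (q : ℂ)) = ((1 + q : ℝ) : ℂ) := by push_cast; rfl
  rw [this, Complex.norm_real, Real.norm_of_nonneg (by linarith)]
  linarith

/-- Variation of `s ↦ (h ∘ flow p s)'(z)`. It is dominated by the increments of the function
`72 M₂ p m / E + 108 M₁ p² / E²` with `m = |z| + p` and `E = p + (1 - s) m`, which increases from a
nonnegative value to `72 M₂ m + 108 M₁` at `s = 1`; so the total variation is bounded uniformly as
`p → 0`. -/
theorem norm_deriv_comp_flow_sub_le {h : ℂ → ℂ} (hh : Differentiable ℂ h) {c r p M₁ M₂ : ℝ}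
    (hr : 0 ≤ r) (hrc : r < c) (hp0 : 0 < p) (hp : p ^ 2 = c ^ 2 - r ^ 2)
    (hM₁ : ∀ w ∈ Metric.closedBall (c : ℂ) r, ‖deriv h w‖ ≤ M₁)
    (hM₂ : ∀ w ∈ Metric.closedBall (c : ℂ) r, ‖deriv (deriv h) w‖ ≤ M₂) {z : ℂ}
    (hz : z ∈ Metric.closedBall (c : ℂ) r) {a b : ℝ} (ha : 0 ≤ a) (hab : a ≤ b) (hb : b ≤ 1) :
    ‖deriv h (flow p b z) * (4 * p ^ 2 * b / ((1 - b) * z + (1 + b) * p) ^ 2) -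
      deriv h (flow p a z) * (4 * p ^ 2 * a / ((1 - a) * z + (1 + a) * p) ^ 2)‖ ≤
    (72 * M₂ * p * (‖z‖ + p) / (p + (1 - b) * (‖z‖ + p)) +
      108 * M₁ * p ^ 2 / (p + (1 - b) * (‖z‖ + p)) ^ 2) -
    (72 * M₂ * p * (‖z‖ + p) / (p + (1 - a) * (‖z‖ + p)) +
      108 * M₁ * p ^ 2 / (p + (1 - a) * (‖z‖ + p)) ^ 2) := by
  have hx := (re_pos_of_mem_closedBall hrc hz).le
  set m : ℝ := ‖z‖ + p with hm
  have hm0 : 0 < m := by positivity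
  have hM₁0 : 0 ≤ M₁ := (norm_nonneg _).trans (hM₁ z hz)
  have hM₂0 : 0 ≤ M₂ := (norm_nonneg _).trans (hM₂ z hz)
  refine norm_sub_le_of_norm_deriv_le
    (F := fun s : ℝ => deriv h (flow p s z) * (4 * p ^ 2 * s / ((1 - s) * z + (1 + s) * p) ^ 2))
    (F' := fun s : ℝ => (deriv (deriv h) (flow p s z) *
        (2 * p * (z - p) * (z + p) / ((1 - s) * z + (1 + s) * p) ^ 2)) *
          (4 * p ^ 2 * s / ((1 - s) * z + (1 + s) * p) ^ 2) +
        deriv h (flow p s z) *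
          (4 * p ^ 2 * ((z + p) + s * (z - p)) / ((1 - s) * z + (1 + s) * p) ^ 3))
    (g := fun s : ℝ => 72 * M₂ * p * m / (p + (1 - s) * m) +
      108 * M₁ * p ^ 2 / (p + (1 - s) * m) ^ 2)
    (g' := fun s : ℝ => 72 * M₂ * p * m ^ 2 / (p + (1 - s) * m) ^ 2 +
      216 * M₁ * p ^ 2 * m / (p + (1 - s) * m) ^ 3) ?_ ?_ ?_ ha hab hb
  · intro s hs
    have hdd : Differentiable ℂ (deriv h) := hh.deriv
    have h1 := (hdd (flow p s z)).hasDerivAt.comp (s : ℂ)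
      (hasDerivAt_flow_param hp0 hs.1 hs.2 hx)
    exact (h1.mul (hasDerivAt_flow_stretch hp0 hs.1 hs.2 hx)).comp_ofReal
  · intro s hs
    have hE : p + (1 - s) * m ≠ 0 := by
      have : 0 ≤ (1 - s) * m := mul_nonneg (sub_nonneg.2 hs.2) hm0.le
      positivity
    have h1 : HasDerivAt (fun s : ℝ => p + (1 - s) * m) (-m) s := by
      convert! (((hasDerivAt_id s).const_sub 1).mul_const m).const_add p using 1
      ring
    have h2 := ((hasDerivAt_const s (72 * M₂ * p * m)).div h1 hE).add
      ((hasDerivAt_const s (108 * M₁ * p ^ 2)).div (h1.pow 2) (pow_ne_zero 2 hE))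
    convert! h2 using 1
    simp only [Pi.pow_apply]
    generalize p + (1 - s) * m = E at hE
    push_cast
    field_simp
    ring
  · intro s hs
    have hfl := flow_mem_closedBall hr hrc hp0 hp hs.1 hs.2 hz
    have hd1 := norm_le_norm_flow_den hp0 hs.1 hs.2 hx
    have hd2 := mul_norm_le_norm_flow_den hp0 hs.1 hs.2 hx
    set E : ℝ := p + (1 - s) * m with hE
    set d : ℂ := (1 - s) * z + (1 + s) * (p : ℂ) with hd
    have hs1 : 0 ≤ 1 - s := sub_nonneg.2 hs.2
    have hE0 : 0 < E := by positivity
    -- the denominator of the flow is comparable to `E`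
    have hEd : E / 3 ≤ ‖d‖ := by
      rw [hE, hm]
      nlinarith [mul_nonneg hs.1 hp0.le]
    have hzm : ‖z - p‖ ≤ m := (norm_sub_le _ _).trans (by simp [hm, abs_of_pos hp0])
    have hzp : ‖z + p‖ ≤ m := (norm_add_le _ _).trans (by simp [hm, abs_of_pos hp0])
    have b1 : ‖2 * (p : ℂ) * (z - p) * (z + p) / d ^ 2‖ ≤ 18 * p * m ^ 2 / E ^ 2 := by
      rw [norm_div, norm_mul, norm_mul, norm_mul, norm_pow, Complex.norm_real,
        Real.norm_of_nonneg hp0.le, Complex.norm_ofNat]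
      calc 2 * p * ‖z - p‖ * ‖z + p‖ / ‖d‖ ^ 2 ≤ 2 * p * m * m / (E / 3) ^ 2 := by gcongr
        _ = 18 * p * m ^ 2 / E ^ 2 := by field_simp; norm_num
    have b2 : ‖4 * (p : ℂ) ^ 2 * s / d ^ 2‖ ≤ 4 := by
      rw [norm_div, norm_mul, norm_mul, norm_pow, norm_pow, Complex.norm_real, Complex.norm_real,
        Real.norm_of_nonneg hp0.le, Real.norm_of_nonneg hs.1, Complex.norm_ofNat]
      calc 4 * p ^ 2 * s / ‖d‖ ^ 2 ≤ 4 * p ^ 2 * 1 / p ^ 2 := by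
            gcongr
            exact hs.2
        _ = 4 := by field_simp
    have b3 : ‖4 * (p : ℂ) ^ 2 * ((z + p) + s * (z - p)) / d ^ 3‖ ≤
        216 * p ^ 2 * m / E ^ 3 := by
      have : ‖(z + p) + s * (z - p)‖ ≤ 2 * m := by
        refine (norm_add_le _ _).trans ?_
        rw [norm_mul, Complex.norm_real, Real.norm_of_nonneg hs.1]
        nlinarith [mul_le_mul hs.2 hzm (norm_nonneg _) zero_le_one]
      rw [norm_div, norm_mul, norm_mul, norm_pow, norm_pow, Complex.norm_real,
        Real.norm_of_nonneg hp0.le, Complex.norm_ofNat]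
      calc 4 * p ^ 2 * ‖(z + p) + s * (z - p)‖ / ‖d‖ ^ 3 ≤ 4 * p ^ 2 * (2 * m) / (E / 3) ^ 3 := by
            gcongr
        _ = 216 * p ^ 2 * m / E ^ 3 := by field_simp; norm_num
    refine (norm_add_le _ _).trans ?_
    rw [norm_mul, norm_mul, norm_mul]
    calc _ ≤ M₂ * (18 * p * m ^ 2 / E ^ 2) * 4 + M₁ * (216 * p ^ 2 * m / E ^ 3) := by
          gcongr
          · exact hM₂ _ hfl
          · exact hM₁ _ hfl
      _ = 72 * M₂ * p * m ^ 2 / E ^ 2 + 216 * M₁ * p ^ 2 * m / E ^ 3 := by ring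

/-- The series `A = ∑ (-q)ⁿ h ∘ flow p μⁿ`, characterised by its functional equation, is holomorphic
in the disk, with a Lipschitz constant that depends neither on `q < 1` nor on `μ`, nor on a lower
bound for `p`. -/
theorem exists_alternating_series {h : ℂ → ℂ} (hh : Differentiable ℂ h) {c r p q μ M₁ M₂ : ℝ}
    (hr : 0 ≤ r) (hrc : r < c) (hp0 : 0 < p) (hp : p ^ 2 = c ^ 2 - r ^ 2)
    (hq0 : 0 ≤ q) (hq1 : q < 1) (hμ0 : 0 ≤ μ) (hμ1 : μ ≤ 1)
    (hM₁ : ∀ w ∈ Metric.closedBall (c : ℂ) r, ‖deriv h w‖ ≤ M₁)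
    (hM₂ : ∀ w ∈ Metric.closedBall (c : ℂ) r, ‖deriv (deriv h) w‖ ≤ M₂) :
    ∃ A : ℂ → ℂ, (∀ z ∈ Metric.closedBall (c : ℂ) r, A z = h z - q * A (flow p μ z)) ∧
      LipschitzOnWith (116 * M₁ + 216 * M₂ * c).toNNReal A (Metric.closedBall (c : ℂ) r) ∧
      DifferentiableOn ℂ A (Metric.ball (c : ℂ) r) := by
  have hc0 : 0 < c := hr.trans_lt hrc
  have hcD : (c : ℂ) ∈ Metric.closedBall (c : ℂ) r := Metric.mem_closedBall_self hr
  have hM₁0 : 0 ≤ M₁ := (norm_nonneg _).trans (hM₁ _ hcD)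
  have hM₂0 : 0 ≤ M₂ := (norm_nonneg _).trans (hM₂ _ hcD)
  have hpow0 : ∀ n : ℕ, 0 ≤ μ ^ n := fun n => pow_nonneg hμ0 n
  have hpow1 : ∀ n : ℕ, μ ^ n ≤ 1 := fun n => pow_le_one₀ hμ0 hμ1
  have hre : ∀ z ∈ Metric.closedBall (c : ℂ) r, 0 ≤ z.re := fun z hz =>
    (re_pos_of_mem_closedBall hrc hz).le
  have hfl : ∀ (n : ℕ), ∀ z ∈ Metric.closedBall (c : ℂ) r,
      flow p ((μ ^ n : ℝ) : ℂ) z ∈ Metric.closedBall (c : ℂ) r := fun n z hz =>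
    flow_mem_closedBall hr hrc hp0 hp (hpow0 n) (hpow1 n) hz
  obtain ⟨M₀, hM₀⟩ := (isCompact_closedBall (c : ℂ) r).exists_bound_of_continuousOn
    hh.continuous.continuousOn
  set F : ℕ → ℂ → ℂ := fun n z => (-(q : ℂ)) ^ n * h (flow p ((μ ^ n : ℝ) : ℂ) z) with hF
  have hFle : ∀ n, ∀ z ∈ Metric.closedBall (c : ℂ) r, ‖F n z‖ ≤ q ^ n * M₀ := by
    intro n z hz
    simp only [hF]
    rw [norm_mul, norm_pow, norm_neg, Complex.norm_real, Real.norm_of_nonneg hq0]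
    gcongr
    exact hM₀ _ (hfl n z hz)
  have hgeo : Summable fun n : ℕ => q ^ n * M₀ := (summable_geometric_of_lt_one hq0 hq1).mul_right _
  have hsum : ∀ z ∈ Metric.closedBall (c : ℂ) r, Summable fun n => F n z := fun z hz =>
    Summable.of_norm_bounded hgeo fun n => hFle n z hz
  have hFd : ∀ (n : ℕ), ∀ z ∈ Metric.closedBall (c : ℂ) r,
      HasDerivAt (F n) ((-(q : ℂ)) ^ n * (deriv h (flow p ((μ ^ n : ℝ) : ℂ) z) *
        (4 * p ^ 2 * (μ ^ n : ℝ) / ((1 - (μ ^ n : ℝ)) * z + (1 + (μ ^ n : ℝ)) * p) ^ 2))) z := by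
    intro n z hz
    exact ((hh _).hasDerivAt.comp z
      (hasDerivAt_flow hp0 (hpow0 n) (hpow1 n) (hre z hz))).const_mul _
  refine ⟨fun z => ∑' n, F n z, ?_, ?_, ?_⟩
  · intro z hz
    dsimp only
    rw [(hsum z hz).tsum_eq_zero_add, ← tsum_mul_left, sub_eq_add_neg, ← tsum_neg]
    congr 1
    · simp only [hF, pow_zero, one_mul, Complex.ofReal_one]
      rw [flow_one (by exact_mod_cast hp0.ne')]
    · refine tsum_congr fun n => ?_
      simp only [hF]
      rw [flow_flow hp0 (hpow0 n) (hpow1 n) hμ0 hμ1 (hre z hz), pow_succ, pow_succ]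
      ring
  · have hpart : ∀ N : ℕ, LipschitzOnWith (116 * M₁ + 216 * M₂ * c).toNNReal
        (fun z => ∑ n ∈ Finset.range N, F n z) (Metric.closedBall (c : ℂ) r) := by
      intro N
      refine (convex_closedBall (c : ℂ) r).lipschitzOnWith_of_nnnorm_hasDerivWithin_le (𝕜 := ℂ)
        (fun z hz => (HasDerivAt.fun_sum fun n _ => hFd n z hz).hasDerivWithinAt) ?_
      intro z hz
      rw [← NNReal.coe_le_coe, coe_nnnorm, Real.coe_toNNReal _ (by positivity)]
      have hzn : ‖z‖ ≤ 2 * c := by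
        have h1 := mem_closedBall_iff_norm.1 hz
        have h2 := norm_sub_norm_le z c
        rw [Complex.norm_real, Real.norm_of_nonneg hc0.le] at h2
        linarith
      have hpc : p ≤ c := by nlinarith
      have hm0 : 0 < ‖z‖ + p := by positivity
      have hd1 : ∀ n : ℕ, p ≤ ‖(1 - (μ ^ n : ℝ)) * z + (1 + (μ ^ n : ℝ)) * (p : ℂ)‖ := fun n =>
        norm_le_norm_flow_den hp0 (hpow0 n) (hpow1 n) (hre z hz)
      have := norm_sum_neg_pow_mul_le (q := q) (M := 4 * M₁)
        (a := fun n => deriv h (flow p ((μ ^ n : ℝ) : ℂ) z) *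
          (4 * p ^ 2 * (μ ^ n : ℝ) / ((1 - (μ ^ n : ℝ)) * z + (1 + (μ ^ n : ℝ)) * p) ^ 2))
        (G := fun n => 72 * M₂ * p * (‖z‖ + p) / (p + (1 - μ ^ n) * (‖z‖ + p)) +
          108 * M₁ * p ^ 2 / (p + (1 - μ ^ n) * (‖z‖ + p)) ^ 2) hq0 hq1.le ?_ ?_ ?_ N
      · refine this.trans ?_
        have e : 72 * M₂ * p * (‖z‖ + p) / (p + (1 - μ ^ 0) * (‖z‖ + p)) +
            108 * M₁ * p ^ 2 / (p + (1 - μ ^ 0) * (‖z‖ + p)) ^ 2 =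
            72 * M₂ * (‖z‖ + p) + 108 * M₁ := by
          simp; field_simp
        rw [e]
        nlinarith
      · intro n
        rw [norm_mul, norm_div, norm_mul, norm_mul, norm_pow, norm_pow, Complex.norm_real,
          Complex.norm_real, Real.norm_of_nonneg hp0.le, Real.norm_of_nonneg (hpow0 n),
          Complex.norm_ofNat, mul_comm 4 M₁]
        refine mul_le_mul (hM₁ _ (hfl n z hz)) ?_ (by positivity) hM₁0
        rw [div_le_iff₀ (pow_pos (hp0.trans_le (hd1 n)) 2)]
        have := pow_le_pow_left₀ hp0.le (hd1 n) 2
        nlinarith [mul_le_mul_of_nonneg_left (hpow1 n) (sq_nonneg p)]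
      · intro n
        exact norm_deriv_comp_flow_sub_le hh hr hrc hp0 hp hM₁ hM₂ hz (hpow0 (n + 1))
          (pow_le_pow_of_le_one hμ0 hμ1 n.le_succ) (hpow1 n)
      · intro n
        have : 0 ≤ (1 - μ ^ n) * (‖z‖ + p) := mul_nonneg (sub_nonneg.2 (hpow1 n)) hm0.le
        positivity
    refine LipschitzOnWith.of_dist_le_mul fun x hx y hy => ?_
    refine le_of_tendsto ((hsum x hx).hasSum.tendsto_sum_nat.dist (hsum y hy).hasSum.tendsto_sum_nat)
      (Eventually.of_forall fun N => (hpart N).dist_le_mul x hx y hy)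
  · exact Complex.differentiableOn_tsum_of_summable_norm hgeo
      (fun n z hz => (hFd n z (Metric.ball_subset_closedBall hz)).differentiableAt.differentiableWithinAt)
      Metric.isOpen_ball (fun n z hz => hFle n z (Metric.ball_subset_closedBall hz))
/-! ### Reflection in a circle and folding of the plane onto a disk -/

/-- Reflection across the circle of centre `c` and radius `r`, for a centre on the real axis. The
centre, whose image should be `∞`, is sent to itself. -/
noncomputable def circleRefl (c r : ℝ) (z : ℂ) : ℂ := c + r ^ 2 / (starRingEnd ℂ) (z - c)

open scoped Classical in
/-- The map which fixes the closed disk of centre `c` and radius `r` and reflects its complement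
into it. -/
noncomputable def diskFold (c r : ℝ) (z : ℂ) : ℂ :=
  if z ∈ Metric.closedBall (c : ℂ) r then z else circleRefl c r z

theorem diskFold_of_mem {c r : ℝ} {z : ℂ} (hz : z ∈ Metric.closedBall (c : ℂ) r) : diskFold c r z = z :=
  if_pos hz

theorem diskFold_of_notMem {c r : ℝ} {z : ℂ} (hz : z ∉ Metric.closedBall (c : ℂ) r) :
    diskFold c r z = circleRefl c r z := if_neg hz

theorem norm_circleRefl_sub {c r : ℝ} (z : ℂ) : ‖circleRefl c r z - c‖ = r ^ 2 / ‖z - c‖ := by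
  simp only [circleRefl, add_sub_cancel_left, norm_div, norm_pow, Complex.norm_real, RCLike.norm_conj,
    Real.norm_eq_abs, sq_abs]

theorem circleRefl_mem_ball {c r : ℝ} (hr : 0 < r) {z : ℂ} (hz : z ∉ Metric.closedBall (c : ℂ) r) :
    circleRefl c r z ∈ Metric.ball (c : ℂ) r := by
  have h : r < ‖z - c‖ := by simpa [dist_eq_norm] using hz
  rw [mem_ball_iff_norm, norm_circleRefl_sub, div_lt_iff₀ (hr.trans h), sq]
  exact mul_lt_mul_of_pos_left h hr

theorem diskFold_mem_closedBall {c r : ℝ} (hr : 0 < r) (z : ℂ) :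
    diskFold c r z ∈ Metric.closedBall (c : ℂ) r := by
  by_cases hz : z ∈ Metric.closedBall (c : ℂ) r
  · rwa [diskFold_of_mem hz]
  · rw [diskFold_of_notMem hz]
    exact Metric.ball_subset_closedBall (circleRefl_mem_ball hr hz)

/-- Reflecting `w` into the disk brings it closer to every point of the disk. -/
theorem norm_sub_circleRefl_le {c r : ℝ} (hr : 0 < r) {z w : ℂ} (hz : z ∈ Metric.closedBall (c : ℂ) r)
    (hw : w ∉ Metric.closedBall (c : ℂ) r) : ‖z - circleRefl c r w‖ ≤ ‖z - w‖ := by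
  have hz' : ‖z - c‖ ≤ r := mem_closedBall_iff_norm.1 hz
  have hw' : r < ‖w - c‖ := by simpa [dist_eq_norm] using hw
  set a : ℂ := z - c with ha
  set b : ℂ := w - c with hb
  have hb0 : b ≠ 0 := norm_pos_iff.1 (hr.trans hw')
  set t : ℝ := r ^ 2 / ‖b‖ ^ 2 with ht
  have ht1 : t ≤ 1 := by
    rw [ht, div_le_one (by positivity)]
    exact pow_le_pow_left₀ hr.le hw'.le 2
  have htb : t * ‖b‖ ^ 2 = r ^ 2 := by rw [ht]; field_simp
  have e1 : z - circleRefl c r w = a - t • b := by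
    have : (r : ℂ) ^ 2 / (starRingEnd ℂ) b = t • b := by
      rw [div_eq_iff ((map_ne_zero _).2 hb0), Complex.real_smul, mul_assoc, Complex.mul_conj,
        Complex.normSq_eq_norm_sq, ← Complex.ofReal_mul, htb]
      push_cast; rfl
    rw [circleRefl, ← hb, this, ha]; ring
  have e2 : z - w = a - b := by rw [ha, hb]; ring
  rw [e1, e2]
  refine le_of_sq_le_sq ?_ (norm_nonneg _)
  rw [norm_sub_sq_real a (t • b), norm_sub_sq_real a b, inner_smul_right, norm_smul, mul_pow, Real.norm_eq_abs,
    sq_abs]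
  have hin : 2 * inner ℝ a b ≤ ‖b‖ ^ 2 * (1 + t) := by
    have h1 := real_inner_le_norm a b
    have h2 : ‖a‖ ^ 2 ≤ r ^ 2 := pow_le_pow_left₀ (norm_nonneg _) hz' 2
    nlinarith [sq_nonneg (‖a‖ - ‖b‖)]
  nlinarith [mul_nonneg (sub_nonneg.2 ht1) (sub_nonneg.2 hin)]

theorem norm_circleRefl_sub_circleRefl_le {c r : ℝ} (hr : 0 < r) {z w : ℂ}
    (hz : z ∉ Metric.closedBall (c : ℂ) r) (hw : w ∉ Metric.closedBall (c : ℂ) r) :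
    ‖circleRefl c r z - circleRefl c r w‖ ≤ ‖z - w‖ := by
  have hz' : r < ‖z - c‖ := by simpa [dist_eq_norm] using hz
  have hw' : r < ‖w - c‖ := by simpa [dist_eq_norm] using hw
  have hz0 : z - c ≠ 0 := norm_pos_iff.1 (hr.trans hz')
  have hw0 : w - c ≠ 0 := norm_pos_iff.1 (hr.trans hw')
  have e : circleRefl c r z - circleRefl c r w =
      (r : ℂ) ^ 2 * (starRingEnd ℂ) (w - z) / ((starRingEnd ℂ) (z - c) * (starRingEnd ℂ) (w - c)) := by
    have h1 : (starRingEnd ℂ) (z - c) ≠ 0 := (map_ne_zero _).2 hz0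
    have h2 : (starRingEnd ℂ) (w - c) ≠ 0 := (map_ne_zero _).2 hw0
    rw [circleRefl, circleRefl, add_sub_add_left_eq_sub, div_sub_div _ _ h1 h2]
    congr 1
    simp only [map_sub]
    ring
  rw [e, norm_div, norm_mul, norm_mul, RCLike.norm_conj, RCLike.norm_conj, RCLike.norm_conj,
    norm_pow, Complex.norm_real, Real.norm_of_nonneg hr.le, norm_sub_rev w z,
    div_le_iff₀ (mul_pos (hr.trans hz') (hr.trans hw')), mul_comm]
  gcongr
  nlinarith

theorem lipschitzWith_diskFold {c r : ℝ} (hr : 0 < r) : LipschitzWith 1 (diskFold c r) := by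
  refine LipschitzWith.of_dist_le_mul fun z w => ?_
  rw [NNReal.coe_one, one_mul, dist_eq_norm, dist_eq_norm]
  by_cases hz : z ∈ Metric.closedBall (c : ℂ) r <;> by_cases hw : w ∈ Metric.closedBall (c : ℂ) r
  · rw [diskFold_of_mem hz, diskFold_of_mem hw]
  · rw [diskFold_of_mem hz, diskFold_of_notMem hw]
    exact norm_sub_circleRefl_le hr hz hw
  · rw [diskFold_of_notMem hz, diskFold_of_mem hw, norm_sub_rev, norm_sub_rev z]
    exact norm_sub_circleRefl_le hr hw hz
  · rw [diskFold_of_notMem hz, diskFold_of_notMem hw]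
    exact norm_circleRefl_sub_circleRefl_le hr hz hw

/-- The conjugate of a holomorphic function composed with a reflection is holomorphic. -/
theorem differentiableAt_conj_comp_circleRefl {c r : ℝ} {g : ℂ → ℂ} {x : ℂ} (hx : x - c ≠ 0)
    (hg : DifferentiableAt ℂ g (circleRefl c r x)) :
    DifferentiableAt ℂ (fun z => (starRingEnd ℂ) (g (circleRefl c r z))) x := by
  have e : ∀ z, circleRefl c r z = (starRingEnd ℂ) (c + r ^ 2 / (z - c)) := fun z => by simp [circleRefl]
  have h1 : DifferentiableAt ℂ (fun z : ℂ => (c : ℂ) + r ^ 2 / (z - c)) x := by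
    refine DifferentiableAt.const_add _ (DifferentiableAt.div (by fun_prop) (by fun_prop) hx)
  have h2 : DifferentiableAt ℂ (starRingEnd ℂ ∘ g ∘ starRingEnd ℂ) ((c : ℂ) + r ^ 2 / (x - c)) := by
    rw [differentiableAt_conj_conj_iff]
    rwa [← e]
  have := h2.comp x h1
  simp only [e]
  exact this

/-- The composition of the two reflections is a time of the flow between their common limit
points. -/
theorem flow_circleRefl {ci ri ce re p : ℝ} (hp0 : 0 < p) (hre : 0 < re)
    (hci : p ^ 2 = ci ^ 2 - ri ^ 2) (hce : p ^ 2 = ce ^ 2 - re ^ 2) (hci0 : 0 < ci) (hce0 : 0 < ce)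
    {y : ℂ} (hyi : y - ci ≠ 0) (hye : y - ce ≠ 0) :
    flow p (((ci - p) * (ce + p) / ((ci + p) * (ce - p)) : ℝ) : ℂ) (circleRefl ce re y) =
      circleRefl ci ri y := by
  have hpce : p < ce := by nlinarith
  have h1 : (starRingEnd ℂ) y - ce ≠ 0 := by
    have := (map_ne_zero (starRingEnd ℂ)).2 hye
    simpa using this
  have h2 : (starRingEnd ℂ) y - ci ≠ 0 := by
    have := (map_ne_zero (starRingEnd ℂ)).2 hyi
    simpa using this
  have hri2 : (ri : ℂ) ^ 2 = ci ^ 2 - p ^ 2 := by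
    rw [eq_sub_iff_add_eq, ← eq_sub_iff_add_eq']; exact_mod_cast hci
  have hre2 : (re : ℂ) ^ 2 = ce ^ 2 - p ^ 2 := by
    rw [eq_sub_iff_add_eq, ← eq_sub_iff_add_eq']; exact_mod_cast hce
  have hc1 : (ci : ℂ) + p ≠ 0 := by exact_mod_cast (by positivity : ci + p ≠ 0)
  have hc2 : (ce : ℂ) - p ≠ 0 := by exact_mod_cast (sub_pos.2 hpce).ne'
  have hc3 : (ce : ℂ) + p ≠ 0 := by exact_mod_cast (by positivity : ce + p ≠ 0)
  have hp' : (p : ℂ) ≠ 0 := by exact_mod_cast hp0.ne'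
  have e0 : circleRefl ce re y = (ce * (starRingEnd ℂ) y - p ^ 2) / ((starRingEnd ℂ) y - ce) := by
    rw [circleRefl, hre2, map_sub, Complex.conj_ofReal, add_div' _ _ _ h1]
    congr 1
    ring
  have e0i : circleRefl ci ri y = (ci * (starRingEnd ℂ) y - p ^ 2) / ((starRingEnd ℂ) y - ci) := by
    rw [circleRefl, hri2, map_sub, Complex.conj_ofReal, add_div' _ _ _ h2]
    congr 1
    ring
  rw [e0, e0i]
  push_cast
  generalize (starRingEnd ℂ) y = Y at h1 h2
  set K : ℂ := 2 * (ce + p) / ((Y - ce) * (ci + p)) with hK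
  have hK0 : K ≠ 0 := div_ne_zero (mul_ne_zero two_ne_zero hc3) (mul_ne_zero h1 hc1)
  set s : ℂ := (ci - p) * (ce + p) / ((ci + p) * (ce - p)) with hs
  have hX1 : (ce * Y - p ^ 2) / (Y - ce) - p = (ce - p) * (Y + p) / (Y - ce) := by
    rw [div_sub' h1]; congr 1; ring
  have hX2 : (ce * Y - p ^ 2) / (Y - ce) + p = (ce + p) * (Y - p) / (Y - ce) := by
    rw [div_add' _ _ _ h1]; congr 1; ring
  have hs1 : s * ((ce - p) * (Y + p) / (Y - ce)) =
      (ci - p) * (ce + p) * (Y + p) / ((Y - ce) * (ci + p)) := by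
    rw [hs, div_mul_div_comm, div_eq_div_iff (by positivity) (by positivity)]
    ring
  have e1 : (1 + s) * ((ce * Y - p ^ 2) / (Y - ce)) + (1 - s) * p = K * (ci * Y - p ^ 2) := by
    have : (1 + s) * ((ce * Y - p ^ 2) / (Y - ce)) + (1 - s) * p =
        ((ce * Y - p ^ 2) / (Y - ce) + p) + s * ((ce * Y - p ^ 2) / (Y - ce) - p) := by ring
    rw [this, hX1, hX2, hs1, hK, ← mul_div_mul_right _ _ hc1, ← add_div, div_mul_eq_mul_div]
    congr 1; ring
  have e2 : (1 - s) * ((ce * Y - p ^ 2) / (Y - ce)) + (1 + s) * p = K * (p * (Y - ci)) := by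
    have : (1 - s) * ((ce * Y - p ^ 2) / (Y - ce)) + (1 + s) * p =
        ((ce * Y - p ^ 2) / (Y - ce) + p) - s * ((ce * Y - p ^ 2) / (Y - ce) - p) := by ring
    rw [this, hX1, hX2, hs1, hK, ← mul_div_mul_right _ _ hc1, ← sub_div, div_mul_eq_mul_div]
    congr 1; ring
  rw [flow, e1, e2, show (p : ℂ) * (K * (ci * Y - p ^ 2)) = (K * p) * (ci * Y - p ^ 2) by ring,
    ← mul_assoc, mul_div_mul_left _ _ (mul_ne_zero hK0 hp')]

/-! ### The explicit solution -/

/-- Where `u` and `v` are locally the real part and `s` times the imaginary part of a holomorphic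
function, `∇v` is `s ∇u` rotated by a right angle. -/
theorem gradient_eq_I_mul_gradient {f : ℂ → ℂ} {u v : ℂ → ℝ} {s : ℝ} {x : ℂ}
    (hf : DifferentiableAt ℂ f x) (hu : u =ᶠ[𝓝 x] fun y => (f y).re)
    (hv : v =ᶠ[𝓝 x] fun y => s * (f y).im) : ∇ v x = Complex.I * (s • ∇ u x) := by
  have h1 : HasFDerivAt f ((ContinuousLinearMap.toSpanSingleton ℂ (deriv f x)).restrictScalars ℝ) x :=
    hf.hasDerivAt.hasFDerivAt.restrictScalars ℝ
  have h2 := (Complex.reCLM.hasFDerivAt.comp x h1).congr_of_eventuallyEq hu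
  have h3 := ((Complex.imCLM.hasFDerivAt.comp x h1).const_mul s).congr_of_eventuallyEq hv
  obtain ⟨a1, a2⟩ := gradient_re_im u x
  obtain ⟨b1, b2⟩ := gradient_re_im v x
  rw [h2.fderiv] at a1 a2
  rw [h3.fderiv] at b1 b2
  simp at a1 a2 b1 b2
  apply Complex.ext
  · simp [a2, b1]
  · simp [a1, b2]

/-- The combination `(a A + b h) ∘ Φ_e + d A ∘ Φ_i`, where `Φ_e` and `Φ_i` fold the plane onto the
closed outer disk and onto the closed core. Both the solution and its conjugate function are, up to
`h`, real or imaginary parts of such combinations. -/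
noncomputable def folded (A h : ℂ → ℂ) (ci ri ce re a b d : ℝ) (z : ℂ) : ℂ :=
  a * A (diskFold ce re z) + b * h (diskFold ce re z) + d * A (diskFold ci ri z)

section folded

variable {A h : ℂ → ℂ} {ci ri ce re : ℝ} {L M : ℝ}

theorem norm_folded_sub_le_of_mem
    (hA : ∀ x ∈ Metric.closedBall (ce : ℂ) re, ∀ y ∈ Metric.closedBall (ce : ℂ) re,
      ‖A x - A y‖ ≤ L * ‖x - y‖)
    (hh : ∀ x ∈ Metric.closedBall (ce : ℂ) re, ∀ y ∈ Metric.closedBall (ce : ℂ) re,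
      ‖h x - h y‖ ≤ M * ‖x - y‖) (a b d : ℝ) {x y x' y' : ℂ}
    (hx : x ∈ Metric.closedBall (ce : ℂ) re) (hy : y ∈ Metric.closedBall (ce : ℂ) re)
    (hx' : x' ∈ Metric.closedBall (ce : ℂ) re) (hy' : y' ∈ Metric.closedBall (ce : ℂ) re) :
    ‖(a * A x + b * h x + d * A x') - (a * A y + b * h y + d * A y')‖ ≤
      (|a| * L + |b| * M) * ‖x - y‖ + |d| * L * ‖x' - y'‖ := by
  have e : (a * A x + b * h x + d * A x') - (a * A y + b * h y + d * A y') =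
    a * (A x - A y) + b * (h x - h y) + d * (A x' - A y') := by ring
  rw [e]
  refine (norm_add₃_le).trans ?_
  rw [norm_mul, norm_mul, norm_mul, Complex.norm_real, Complex.norm_real, Complex.norm_real,
    Real.norm_eq_abs, Real.norm_eq_abs, Real.norm_eq_abs]
  have h1 := mul_le_mul_of_nonneg_left (hA x hx y hy) (abs_nonneg a)
  have h2 := mul_le_mul_of_nonneg_left (hh x hx y hy) (abs_nonneg b)
  have h3 := mul_le_mul_of_nonneg_left (hA x' hx' y' hy') (abs_nonneg d)
  linarith

theorem norm_folded_sub_le (hri : 0 < ri) (hre : 0 < re)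
    (hsub : Metric.closedBall (ci : ℂ) ri ⊆ Metric.closedBall (ce : ℂ) re) (hL : 0 ≤ L) (hM : 0 ≤ M)
    (hA : ∀ x ∈ Metric.closedBall (ce : ℂ) re, ∀ y ∈ Metric.closedBall (ce : ℂ) re,
      ‖A x - A y‖ ≤ L * ‖x - y‖)
    (hh : ∀ x ∈ Metric.closedBall (ce : ℂ) re, ∀ y ∈ Metric.closedBall (ce : ℂ) re,
      ‖h x - h y‖ ≤ M * ‖x - y‖) (a b d : ℝ) (x y : ℂ) :
    ‖folded A h ci ri ce re a b d x - folded A h ci ri ce re a b d y‖ ≤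
      (|a| * L + |b| * M + |d| * L) * ‖x - y‖ := by
  refine (norm_folded_sub_le_of_mem hA hh a b d (diskFold_mem_closedBall hre x)
    (diskFold_mem_closedBall hre y) (hsub (diskFold_mem_closedBall hri x))
    (hsub (diskFold_mem_closedBall hri y))).trans ?_
  have h1 : ‖diskFold ce re x - diskFold ce re y‖ ≤ ‖x - y‖ := by
    simpa [dist_eq_norm] using (lipschitzWith_diskFold (c := ce) hre).dist_le_mul x y
  have h2 : ‖diskFold ci ri x - diskFold ci ri y‖ ≤ ‖x - y‖ := by
    simpa [dist_eq_norm] using (lipschitzWith_diskFold (c := ci) hri).dist_le_mul x y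
  have h3 : 0 ≤ |a| * L + |b| * M := by positivity
  have h4 : 0 ≤ |d| * L := by positivity
  nlinarith [mul_le_mul_of_nonneg_left h1 h3, mul_le_mul_of_nonneg_left h2 h4]

theorem isBigO_folded_sub (hri : 0 < ri) (hre : 0 < re) (hci : 0 < ci) (hce : 0 < ce)
    (hsub : Metric.closedBall (ci : ℂ) ri ⊆ Metric.closedBall (ce : ℂ) re) (hL : 0 ≤ L) (hM : 0 ≤ M)
    (hA : ∀ x ∈ Metric.closedBall (ce : ℂ) re, ∀ y ∈ Metric.closedBall (ce : ℂ) re,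
      ‖A x - A y‖ ≤ L * ‖x - y‖)
    (hh : ∀ x ∈ Metric.closedBall (ce : ℂ) re, ∀ y ∈ Metric.closedBall (ce : ℂ) re,
      ‖h x - h y‖ ≤ M * ‖x - y‖) (a b d : ℝ) :
    (fun x => folded A h ci ri ce re a b d x - (a * A ce + b * h ce + d * A ci))
      =O[cocompact ℂ] (fun x => ‖x‖⁻¹) := by
  refine Asymptotics.IsBigO.of_bound ((|a| * L + |b| * M) * (2 * re ^ 2) + |d| * L * (2 * ri ^ 2)) ?_
  rw [← Metric.cobounded_eq_cocompact, ← comap_norm_atTop]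
  refine eventually_comap.2 ?_
  filter_upwards [eventually_gt_atTop (2 * (ce + re + ci + ri))] with R hR x hx
  have key : ∀ c r : ℝ, 0 < c → 0 < r → 2 * (c + r) < R →
      ‖diskFold c r x - c‖ ≤ 2 * r ^ 2 * ‖x‖⁻¹ := by
    intro c r hc hr hcr
    have h1 : ‖x‖ / 2 ≤ ‖x - c‖ := by
      have := norm_sub_norm_le x c
      rw [Complex.norm_real, Real.norm_of_nonneg hc.le] at this
      linarith
    have h2 : x ∉ Metric.closedBall (c : ℂ) r := by
      rw [mem_closedBall_iff_norm]; linarith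
    have h3 : 0 < ‖x‖ := by linarith
    rw [diskFold_of_notMem h2, norm_circleRefl_sub]
    calc r ^ 2 / ‖x - c‖ ≤ r ^ 2 / (‖x‖ / 2) := by gcongr
      _ = 2 * r ^ 2 * ‖x‖⁻¹ := by field_simp
  have k1 := key ce re hce hre (by linarith)
  have k2 := key ci ri hci hri (by linarith)
  refine (norm_folded_sub_le_of_mem hA hh a b d (diskFold_mem_closedBall hre x)
    (Metric.mem_closedBall_self hre.le) (hsub (diskFold_mem_closedBall hri x))
    (hsub (Metric.mem_closedBall_self hri.le))).trans ?_
  rw [norm_inv, norm_norm]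
  have h3 : 0 ≤ |a| * L + |b| * M := by positivity
  have h4 : 0 ≤ |d| * L := by positivity
  nlinarith [mul_le_mul_of_nonneg_left k1 h3, mul_le_mul_of_nonneg_left k2 h4]

end folded

/-- Off the two circles `v = Im (h - (h - k_e A) ∘ Φ_e - k_e β A ∘ Φ_i)` is conjugate to
`u = Re (h + (A - h) ∘ Φ_e + β A ∘ Φ_i)`, in the sense that `∇v = i σ ∇u`. In the core this holds
because `k_e (1 - β) = k_i (1 + β)`, in the shell by inspection, and outside by the functional
equation of `A` at the reflected point. -/
theorem gradient_conjugate_eq {A h : ℂ → ℂ} {ci ri ce re p ki ke κ : ℝ} (hh : Differentiable ℂ h)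
    (hp0 : 0 < p) (hri : 0 < ri) (hre : 0 < re) (hci0 : 0 < ci) (hce0 : 0 < ce)
    (hci : p ^ 2 = ci ^ 2 - ri ^ 2) (hce : p ^ 2 = ce ^ 2 - re ^ 2)
    (hsub : Metric.closedBall (ci : ℂ) ri ⊆ Metric.ball (ce : ℂ) re)
    (hki : 0 < ki) (hke : 0 < ke)
    (hA : DifferentiableOn ℂ A (Metric.ball (ce : ℂ) re))
    (hfun : ∀ z ∈ Metric.closedBall (ce : ℂ) re,
      A z = 2 / (1 + ke) * h z + (ke - 1) / (ke + 1) * ((ke - ki) / (ke + ki)) *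
        A (flow p (((ci - p) * (ce + p) / ((ci + p) * (ce - p)) : ℝ) : ℂ) z))
    {σ : ℂ → ℝ} (hσi : ∀ x ∈ Metric.ball (ci : ℂ) ri, σ x = ki)
    (hσe : ∀ x ∈ Metric.ball (ce : ℂ) re, x ∉ Metric.ball (ci : ℂ) ri → σ x = ke)
    (hσ0 : ∀ x, x ∉ Metric.ball (ce : ℂ) re → σ x = 1)
    {x : ℂ} (hxi : x ∉ Metric.sphere (ci : ℂ) ri) (hxe : x ∉ Metric.sphere (ce : ℂ) re) :
    ∇ (fun z => (h z).im +
      (folded A h ci ri ce re ke (-1) (-(ke * ((ke - ki) / (ke + ki)))) z).im) x =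
      Complex.I * (σ x • ∇ (fun z => (h z).re +
        (folded A h ci ri ce re 1 (-1) ((ke - ki) / (ke + ki)) z).re - κ) x) := by
  set β : ℝ := (ke - ki) / (ke + ki) with hβ
  have hAd : ∀ z ∈ Metric.ball (ce : ℂ) re, DifferentiableAt ℂ A z := fun z hz =>
    (hA z hz).differentiableAt (Metric.isOpen_ball.mem_nhds hz)
  have hkb : ke * (1 - β) = ki * (1 + β) := by rw [hβ]; field_simp; ring
  by_cases h1 : x ∈ Metric.ball (ci : ℂ) ri
  · have hxe' := hsub (Metric.ball_subset_closedBall h1)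
    have hev : ∀ᶠ y in 𝓝 x, diskFold ce re y = y ∧ diskFold ci ri y = y := by
      filter_upwards [Metric.isOpen_ball.mem_nhds h1] with y hy
      exact ⟨diskFold_of_mem (Metric.ball_subset_closedBall (hsub (Metric.ball_subset_closedBall hy))),
        diskFold_of_mem (Metric.ball_subset_closedBall hy)⟩
    rw [hσi x h1]
    refine gradient_eq_I_mul_gradient (f := fun z => (1 + β) * A z - κ)
      (((hAd x hxe').const_mul _).sub_const _) ?_ ?_
    · filter_upwards [hev] with y hy
      simp only [folded, hy.1, hy.2]
      simp
      ring
    · filter_upwards [hev] with y hy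
      simp only [folded, hy.1, hy.2]
      simp
      linear_combination (A y).im * hkb
  · have h1c : x ∉ Metric.closedBall (ci : ℂ) ri := fun hx => by
      rcases (Metric.mem_closedBall.1 hx).lt_or_eq with h | h
      · exact h1 h
      · exact hxi h
    have hxci : x - ci ≠ 0 := by
      intro h0
      exact h1 (by rw [mem_ball_iff_norm, h0, norm_zero]; exact hri)
    have hevi : ∀ᶠ y in 𝓝 x, diskFold ci ri y = circleRefl ci ri y ∧ y - ci ≠ 0 := by
      filter_upwards [Metric.isClosed_closedBall.isOpen_compl.mem_nhds h1c] with y hy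
      refine ⟨diskFold_of_notMem hy, fun h0 => hy ?_⟩
      rw [mem_closedBall_iff_norm, h0, norm_zero]; exact hri.le
    have hAi : DifferentiableAt ℂ (fun z => (starRingEnd ℂ) (A (circleRefl ci ri z))) x :=
      differentiableAt_conj_comp_circleRefl hxci
        (hAd _ (hsub (Metric.ball_subset_closedBall (circleRefl_mem_ball hri h1c))))
    by_cases h2 : x ∈ Metric.ball (ce : ℂ) re
    · rw [hσe x h2 h1]
      have hev : ∀ᶠ y in 𝓝 x, diskFold ce re y = y := by
        filter_upwards [Metric.isOpen_ball.mem_nhds h2] with y hy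
        exact diskFold_of_mem (Metric.ball_subset_closedBall hy)
      refine gradient_eq_I_mul_gradient
        (f := fun z => A z + β * (starRingEnd ℂ) (A (circleRefl ci ri z)) - κ)
        (((hAd x h2).add (hAi.const_mul _)).sub_const _) ?_ ?_
      · filter_upwards [hev, hevi] with y hy hyi
        simp only [folded, hy, hyi.1]
        simp
        ring
      · filter_upwards [hev, hevi] with y hy hyi
        simp only [folded, hy, hyi.1]
        simp
        ring
    · have h2c : x ∉ Metric.closedBall (ce : ℂ) re := fun hx => by
        rcases (Metric.mem_closedBall.1 hx).lt_or_eq with h | h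
        · exact h2 h
        · exact hxe h
      have hxce : x - ce ≠ 0 := by
        intro h0
        exact h2 (by rw [mem_ball_iff_norm, h0, norm_zero]; exact hre)
      have heve : ∀ᶠ y in 𝓝 x, diskFold ce re y = circleRefl ce re y ∧ y - ce ≠ 0 ∧
          circleRefl ce re y ∈ Metric.closedBall (ce : ℂ) re := by
        filter_upwards [Metric.isClosed_closedBall.isOpen_compl.mem_nhds h2c] with y hy
        refine ⟨diskFold_of_notMem hy, fun h0 => hy ?_,
          Metric.ball_subset_closedBall (circleRefl_mem_ball hre hy)⟩
        rw [mem_closedBall_iff_norm, h0, norm_zero]; exact hre.le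
      have hAe : DifferentiableAt ℂ (fun z => (starRingEnd ℂ) (A (circleRefl ce re z))) x :=
        differentiableAt_conj_comp_circleRefl hxce (hAd _ (circleRefl_mem_ball hre h2c))
      have hhe : DifferentiableAt ℂ (fun z => (starRingEnd ℂ) (h (circleRefl ce re z))) x :=
        differentiableAt_conj_comp_circleRefl hxce (hh _)
      rw [hσ0 x h2]
      refine gradient_eq_I_mul_gradient
        (f := fun z => h z + ((starRingEnd ℂ) (A (circleRefl ce re z)) -
          (starRingEnd ℂ) (h (circleRefl ce re z))) + β * (starRingEnd ℂ) (A (circleRefl ci ri z)) - κ)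
        ((((hh x).add (hAe.sub hhe)).add (hAi.const_mul _)).sub_const _) ?_ ?_
      · filter_upwards [heve, hevi] with y hy hyi
        simp only [folded, hy.1, hyi.1]
        simp
        ring
      · filter_upwards [heve, hevi] with y hy hyi
        -- the functional equation of `A` balances the fluxes across the outer circle
        have hf := hfun _ hy.2.2
        rw [flow_circleRefl hp0 hre hci hce hci0 hce0 hyi.2 hy.2.1] at hf
        have hf2 : (1 + ke : ℂ) * A (circleRefl ce re y) =
            2 * h (circleRefl ce re y) + (ke - 1) * β * A (circleRefl ci ri y) := by
          have hk : (1 + ke : ℂ) ≠ 0 := by exact_mod_cast (by positivity : 1 + ke ≠ 0)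
          have hk' : (ke + 1 : ℂ) ≠ 0 := by rwa [add_comm]
          rw [hf, hβ]
          push_cast
          rw [mul_add, ← mul_assoc, mul_div_cancel₀ _ hk, ← mul_assoc, ← mul_assoc, add_comm 1 (ke : ℂ),
            mul_div_cancel₀ _ hk']
        have hf3 := congrArg Complex.im hf2
        simp only [folded, hy.1, hyi.1]
        simp at hf3 ⊢
        linear_combination hf3

/-! ### Geometry of the core-shell structure -/

theorem coreCenter_mul {r_i r_e ε : ℝ} (h : ε < r_e - r_i) :
    coreCenter r_i r_e ε * (2 * (r_e - r_i - ε)) =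
      r_e ^ 2 - r_i ^ 2 - (r_e - r_i - ε) ^ 2 :=
  div_mul_cancel₀ _ (by linarith)

theorem radius_lt_coreCenter {r_i r_e ε : ℝ} (hri : 0 < r_i) (hε : 0 < ε) (h : ε < r_e - r_i) :
    r_i < coreCenter r_i r_e ε := by
  have h1 := coreCenter_mul h
  have hd : 0 < r_e - r_i - ε := by linarith
  by_contra! hc
  nlinarith [mul_le_mul_of_nonneg_right hc (by linarith : 0 ≤ 2 * (r_e - r_i - ε))]

theorem coreCenter_sq_sub {r_i r_e ε : ℝ} (h : ε < r_e - r_i) :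
    coreCenter r_i r_e ε ^ 2 - r_i ^ 2 = shellCenter r_i r_e ε ^ 2 - r_e ^ 2 := by
  have h1 := coreCenter_mul h
  rw [shellCenter]
  linear_combination -h1

theorem radius_lt_shellCenter {r_i r_e ε : ℝ} (hri : 0 < r_i) (hε : 0 < ε) (h : ε < r_e - r_i) :
    r_e < shellCenter r_i r_e ε := by
  have h1 := coreCenter_sq_sub h
  have h2 := radius_lt_coreCenter hri hε h
  have h3 : 0 < shellCenter r_i r_e ε := by rw [shellCenter]; linarith
  nlinarith

theorem closedBall_core_subset {r_i r_e ε : ℝ} (hε : 0 < ε) (h : ε < r_e - r_i) :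
    Metric.closedBall (coreCenter r_i r_e ε : ℂ) r_i ⊆
      Metric.ball (shellCenter r_i r_e ε : ℂ) r_e := by
  refine Metric.closedBall_subset_ball' ?_
  rw [dist_eq_norm, ← Complex.ofReal_sub, Complex.norm_real, shellCenter, Real.norm_eq_abs,
    abs_sub_comm, abs_of_nonneg (by linarith)]
  linarith

/-- The centres stay bounded, uniformly in `ε ≤ ε₀`. -/
theorem shellCenter_le {r_i r_e ε ε₀ : ℝ} (hri : 0 < r_i) (hε : 0 < ε) (hle : ε ≤ ε₀)
    (h : ε₀ < r_e - r_i) : shellCenter r_i r_e ε ≤ r_e ^ 2 / (2 * (r_e - r_i - ε₀)) + r_e := by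
  have h1 : coreCenter r_i r_e ε ≤ r_e ^ 2 / (2 * (r_e - r_i - ε₀)) := by
    rw [coreCenter]
    have h0 : 0 < r_e - r_i - ε₀ := by linarith
    refine div_le_div₀ (by positivity) ?_ (by positivity) (by linarith)
    nlinarith [sq_nonneg (r_e - r_i - ε), sq_nonneg r_i]
  rw [shellCenter]
  linarith

theorem measurable_conductivity (r_i r_e ε k_i k_e : ℝ) :
    Measurable (conductivity r_i r_e ε k_i k_e) := by
  unfold conductivity
  exact Measurable.ite Metric.isOpen_ball.measurableSet measurable_const
    (Measurable.ite Metric.isOpen_ball.measurableSet measurable_const measurable_const)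

/-- Ellipticity of the conductivity. -/
theorem conductivity_mem (r_i r_e ε k_i k_e : ℝ) (x : ℂ) :
    min k_i (min k_e 1) ≤ conductivity r_i r_e ε k_i k_e x ∧
      conductivity r_i r_e ε k_i k_e x ≤ max k_i (max k_e 1) := by
  unfold conductivity
  split_ifs <;> simp

theorem quarter_lt_lambda_mul_lambda_iff {k_i k_e : ℝ} (hki : 0 < k_i) (hke : 0 < k_e) :
    1 / 4 < lambdaI k_i k_e * lambdaE k_e ↔
      (k_e < k_i ∧ 1 < k_e) ∨ (k_i < k_e ∧ k_e < 1) := by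
  rw [lambdaI, lambdaE, div_mul_div_comm]
  have hN : 0 < (k_i + k_e) * (k_e + 1) := by positivity
  have hD : 2 * (k_i - k_e) * (2 * (k_e - 1)) = 4 * ((k_i - k_e) * (k_e - 1)) := by ring
  rw [hD]
  constructor
  · intro h
    have hpos : 0 < (k_i - k_e) * (k_e - 1) := by
      by_contra! hc
      have := div_nonpos_of_nonneg_of_nonpos hN.le (by linarith : 4 * ((k_i - k_e) * (k_e - 1)) ≤ 0)
      linarith
    rcases pos_and_pos_or_neg_and_neg_of_mul_pos hpos with ⟨h1, h2⟩ | ⟨h1, h2⟩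
    · left; constructor <;> linarith
    · right; constructor <;> linarith
  · intro h
    have hpos : 0 < (k_i - k_e) * (k_e - 1) := by
      rcases h with ⟨h1, h2⟩ | ⟨h1, h2⟩
      · exact mul_pos (by linarith) (by linarith)
      · exact mul_pos_of_neg_of_neg (by linarith) (by linarith)
    rw [div_lt_div_iff₀ (by norm_num) (by positivity)]
    nlinarith

/-- The number `q` with `-q` the ratio of the image series, equal to `1 / (4 λ_i λ_e)`, lies in
`[0, 1)`. -/
theorem ratio_nonneg_and_lt_one {k_i k_e : ℝ} (hki : 0 < k_i) (hke : 0 < k_e)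
    (h : (k_e < k_i ∧ 1 < k_e) ∨ (k_i < k_e ∧ k_e < 1)) :
    0 ≤ -((k_e - 1) / (k_e + 1) * ((k_e - k_i) / (k_e + k_i))) ∧
      -((k_e - 1) / (k_e + 1) * ((k_e - k_i) / (k_e + k_i))) < 1 := by
  rw [div_mul_div_comm, ← neg_div, div_lt_one (by positivity)]
  constructor
  · refine div_nonneg ?_ (by positivity)
    rcases h with ⟨h1, h2⟩ | ⟨h1, h2⟩ <;> nlinarith
  · nlinarith [mul_pos hki hke, mul_pos hke hke]

/-! ### Uniform gradient bound -/

theorem integrable_mul_inner {σ : ℂ → ℝ} {F g : ℂ → ℂ} {M : ℝ} (hσ : Measurable σ)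
    (hM : ∀ x, |σ x| ≤ M) (hF : LocallyIntegrable F volume) (hg : Continuous g)
    (hgc : HasCompactSupport g) : Integrable (fun x => σ x * inner ℝ (F x) (g x)) volume := by
  have h1 : Integrable (fun x => ‖g x‖ • F x) volume :=
    hF.integrable_smul_left_of_hasCompactSupport hg.norm hgc.norm
  refine (h1.norm.const_mul M).mono' (hσ.aestronglyMeasurable.mul
    (hF.aestronglyMeasurable.inner hg.aestronglyMeasurable)) (ae_of_all _ fun x => ?_)
  rw [norm_mul, norm_smul, norm_norm, mul_comm ‖g x‖]
  exact mul_le_mul (hM x) (norm_inner_le_norm _ _) (norm_nonneg _) ((abs_nonneg _).trans (hM x))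

/-- The gradient bound with an explicit constant: it involves only bounds of `h'` and `h''` on a disk
which contains `B_e`. -/
theorem eLpNorm_sub_gradient_le {r_i r_e ε k_i k_e c M₁ M₂ : ℝ} {h : ℂ → ℂ} (hri : 0 < r_i)
    (hε : 0 < ε) (hlt : ε < r_e - r_i) (hki : 0 < k_i) (hke : 0 < k_e)
    (hk : (k_e < k_i ∧ 1 < k_e) ∨ (k_i < k_e ∧ k_e < 1)) (hh : Differentiable ℂ h)
    (hc : shellCenter r_i r_e ε ≤ c)
    (hM₁ : ∀ w ∈ Metric.closedBall (0 : ℂ) (2 * c), ‖deriv h w‖ ≤ M₁)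
    (hM₂ : ∀ w ∈ Metric.closedBall (0 : ℂ) (2 * c), ‖deriv (deriv h) w‖ ≤ M₂)
    {u : ℂ → ℝ} {G : ℂ → ℂ}
    (hu : IsSolution (conductivity r_i r_e ε k_i k_e) (fun z => (h z).re) u G) :
    eLpNorm (fun x => G x - ∇ (fun z => (h z).re) x) ∞ volume ≤
      ENNReal.ofReal (2 * (2 * (116 * M₁ + 216 * M₂ * c)) + M₁) := by
  have hre : 0 < r_e := by linarith
  set ci : ℝ := coreCenter r_i r_e ε with hci
  set ce : ℝ := shellCenter r_i r_e ε with hce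
  have hrci : r_i < ci := radius_lt_coreCenter hri hε hlt
  have hrce : r_e < ce := radius_lt_shellCenter hri hε hlt
  have hci0 : 0 < ci := hri.trans hrci
  have hce0 : 0 < ce := hre.trans hrce
  have hcice : ci ≤ ce := by rw [hce, shellCenter, ← hci]; linarith
  set p : ℝ := Real.sqrt (ci ^ 2 - r_i ^ 2) with hpdef
  have hpos : 0 < ci ^ 2 - r_i ^ 2 := by nlinarith
  have hp0 : 0 < p := Real.sqrt_pos.2 hpos
  have hpi : p ^ 2 = ci ^ 2 - r_i ^ 2 := Real.sq_sqrt hpos.le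
  have hpe : p ^ 2 = ce ^ 2 - r_e ^ 2 := hpi.trans (coreCenter_sq_sub hlt)
  have hpci : p < ci := by nlinarith
  have hpce : p < ce := hpci.trans_le hcice
  have hsub' : Metric.closedBall (ci : ℂ) r_i ⊆ Metric.ball (ce : ℂ) r_e :=
    closedBall_core_subset hε hlt
  have hsub := hsub'.trans Metric.ball_subset_closedBall
  have hbig : Metric.closedBall (ce : ℂ) r_e ⊆ Metric.closedBall (0 : ℂ) (2 * c) := by
    refine Metric.closedBall_subset_closedBall' ?_
    rw [dist_zero_right, Complex.norm_real, Real.norm_of_nonneg hce0.le]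
    linarith
  have hceD : (ce : ℂ) ∈ Metric.closedBall (ce : ℂ) r_e := Metric.mem_closedBall_self hre.le
  have hM₁0 : 0 ≤ M₁ := (norm_nonneg _).trans (hM₁ _ (hbig hceD))
  have hM₂0 : 0 ≤ M₂ := (norm_nonneg _).trans (hM₂ _ (hbig hceD))
  set μ : ℝ := (ci - p) * (ce + p) / ((ci + p) * (ce - p)) with hμ
  have hμd : 0 < (ci + p) * (ce - p) := mul_pos (by linarith) (by linarith)
  have hμ0 : 0 ≤ μ := div_nonneg (mul_nonneg (by linarith) (by linarith)) hμd.le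
  have hμ1 : μ ≤ 1 := by
    rw [hμ, div_le_one hμd]
    nlinarith
  set β : ℝ := (k_e - k_i) / (k_e + k_i) with hβ
  obtain ⟨hq0, hq1⟩ := ratio_nonneg_and_lt_one hki hke hk
  rw [← hβ] at hq0 hq1
  set q : ℝ := -((k_e - 1) / (k_e + 1) * β) with hq
  have hβ1 : |β| ≤ 1 := by
    rw [hβ, abs_div, abs_of_pos (by positivity : 0 < k_e + k_i), div_le_one (by positivity), abs_le]
    constructor <;> linarith
  set α : ℝ := 2 / (1 + k_e) with hα
  have hα0 : 0 ≤ α := by positivity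
  have hα2 : α ≤ 2 := by
    rw [hα, div_le_iff₀ (by positivity)]; linarith
  have hdα : deriv (fun z => (α : ℂ) * h z) = fun z => (α : ℂ) * deriv h z := by
    ext z; exact deriv_const_mul _ (hh z)
  obtain ⟨A, hAfun, hAL, hAd⟩ := exists_alternating_series (h := fun z => (α : ℂ) * h z)
    (hh.const_mul _) (c := ce) (r := r_e) (p := p) (q := q) (μ := μ) (M₁ := 2 * M₁) (M₂ := 2 * M₂)
    hre.le hrce hp0 hpe hq0 hq1 hμ0 hμ1
    (fun w hw => by
      rw [hdα, norm_mul, Complex.norm_real, Real.norm_of_nonneg hα0]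
      exact mul_le_mul hα2 (hM₁ w (hbig hw)) (norm_nonneg _) (by norm_num))
    (fun w hw => by
      rw [hdα, deriv_const_mul _ (hh.deriv w), norm_mul, Complex.norm_real,
        Real.norm_of_nonneg hα0]
      exact mul_le_mul hα2 (hM₂ w (hbig hw)) (norm_nonneg _) (by norm_num))
  set L : ℝ := 2 * (116 * M₁ + 216 * M₂ * c) with hL
  have hc0 : 0 < c := hce0.trans_le hc
  have hL0 : 0 ≤ L := by positivity
  have hA : ∀ x ∈ Metric.closedBall (ce : ℂ) r_e, ∀ y ∈ Metric.closedBall (ce : ℂ) r_e,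
      ‖A x - A y‖ ≤ L * ‖x - y‖ := by
    intro x hx y hy
    have := hAL.dist_le_mul x hx y hy
    rw [Real.coe_toNNReal _ (by positivity), dist_eq_norm, dist_eq_norm] at this
    refine this.trans (mul_le_mul_of_nonneg_right ?_ (norm_nonneg _))
    rw [hL]
    nlinarith [mul_le_mul_of_nonneg_left hc hM₂0]
  have hhL : ∀ x ∈ Metric.closedBall (ce : ℂ) r_e, ∀ y ∈ Metric.closedBall (ce : ℂ) r_e,
      ‖h x - h y‖ ≤ M₁ * ‖x - y‖ := fun x hx y hy =>
    (convex_closedBall (ce : ℂ) r_e).norm_image_sub_le_of_norm_deriv_le (fun z _ => hh z)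
      (fun z hz => hM₁ z (hbig hz)) hy hx
  have hfun : ∀ z ∈ Metric.closedBall (ce : ℂ) r_e,
      A z = 2 / (1 + k_e) * h z + (k_e - 1) / (k_e + 1) * ((k_e - k_i) / (k_e + k_i)) *
        A (flow p (μ : ℂ) z) := by
    intro z hz
    rw [hAfun z hz, hq, hα, hβ]
    push_cast
    ring
  -- the explicit solution and its conjugate function
  set P : ℂ → ℂ := folded A h ci r_i ce r_e 1 (-1) β with hP
  set Q : ℂ → ℂ := folded A h ci r_i ce r_e k_e (-1) (-(k_e * β)) with hQ
  -- the value at infinity of `Re P`, subtracted to obtain the prescribed decay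
  set κ : ℝ := ((1 : ℝ) * A ce + (-1 : ℝ) * h ce + β * A ci).re with hκ
  set w : ℂ → ℝ := fun z => (h z).re + (P z).re - κ with hw
  set v : ℂ → ℝ := fun z => (h z).im + (Q z).im with hv
  have hPL : LipschitzWith (2 * L + M₁).toNNReal fun z => (P z).re := by
    refine LipschitzWith.of_dist_le_mul fun x y => ?_
    rw [Real.coe_toNNReal _ (by positivity), Real.dist_eq, dist_eq_norm, ← Complex.sub_re]
    refine (Complex.abs_re_le_norm _).trans ((norm_folded_sub_le hri hre hsub hL0 hM₁0 hA hhL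
      1 (-1) β x y).trans ?_)
    refine mul_le_mul_of_nonneg_right ?_ (norm_nonneg _)
    rw [abs_neg, abs_one]
    nlinarith [mul_le_mul_of_nonneg_right hβ1 hL0]
  have hQL : LocallyLipschitz fun z => (Q z).im := by
    refine LipschitzWith.locallyLipschitz (K := (|k_e| * L + |(-1 : ℝ)| * M₁ +
      |-(k_e * β)| * L).toNNReal) (LipschitzWith.of_dist_le_mul fun x y => ?_)
    rw [Real.coe_toNNReal _ (by positivity), Real.dist_eq, dist_eq_norm, ← Complex.sub_im]
    exact (Complex.abs_im_le_norm _).trans (norm_folded_sub_le hri hre hsub hL0 hM₁0 hA hhL _ _ _ x y)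
  have hhc : ContDiff ℝ 1 h := hh.contDiff.restrict_scalars ℝ
  have hre1 : ContDiff ℝ 1 fun z => (h z).re := Complex.reCLM.contDiff.comp hhc
  have him1 : ContDiff ℝ 1 fun z => (h z).im := Complex.imCLM.contDiff.comp hhc
  have hwL : LocallyLipschitz w :=
    (hre1.locallyLipschitz.add hPL.locallyLipschitz).sub (LocallyLipschitz.const κ)
  have hvL : LocallyLipschitz v := him1.locallyLipschitz.add hQL
  have hconj : ∀ᵐ x, ∇ v x = Complex.I * (conductivity r_i r_e ε k_i k_e x • ∇ w x) := by
    have s1 : volume (Metric.sphere (ci : ℂ) r_i) = 0 := Measure.addHaar_sphere _ _ _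
    have s2 : volume (Metric.sphere (ce : ℂ) r_e) = 0 := Measure.addHaar_sphere _ _ _
    filter_upwards [measure_eq_zero_iff_ae_notMem.1 s1, measure_eq_zero_iff_ae_notMem.1 s2]
      with x h1 h2
    refine gradient_conjugate_eq hh hp0 hri hre hci0 hce0 hpi hpe hsub' hki hke hAd hfun
      ?_ ?_ ?_ h1 h2
    · intro y hy
      exact if_pos hy
    · intro y hy hy'
      exact (if_neg hy').trans (if_pos hy)
    · intro y hy
      exact (if_neg fun hy' => hy (hsub' (Metric.ball_subset_closedBall hy'))).trans (if_neg hy)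
  -- the difference of the two solutions has vanishing gradient
  have hweak := hu.weakGradient.sub (isWeakGradient_gradient hwL)
  have hlo : 0 < min k_i (min k_e 1) := by positivity
  have hzero := hweak.ae_eq_zero (measurable_conductivity r_i r_e ε k_i k_e) hlo
    (fun x => (conductivity_mem r_i r_e ε k_i k_e x).1)
    (fun x => (conductivity_mem r_i r_e ε k_i k_e x).2)
    (fun φ hφ hc => by
      have hi : ∀ F : ℂ → ℂ, LocallyIntegrable F volume → Integrable
          (fun x => conductivity r_i r_e ε k_i k_e x * inner ℝ (F x) (∇ φ x)) volume := fun F hF =>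
        integrable_mul_inner (measurable_conductivity r_i r_e ε k_i k_e)
          (fun x => abs_le.2 ⟨by linarith [(conductivity_mem r_i r_e ε k_i k_e x).1,
              (conductivity_mem r_i r_e ε k_i k_e x).2],
            (conductivity_mem r_i r_e ε k_i k_e x).2⟩) hF (continuous_gradient hφ)
          (hasCompactSupport_gradient hc)
      simp only [inner_sub_left, mul_sub]
      rw [integral_sub (hi _ (locallyIntegrable_of_memLp hu.weakGradient.memLp_grad))
        (hi _ (locallyIntegrable_of_memLp fun K hK => memLp_gradient hwL hK)),
        hu.equation φ hφ hc, integral_mul_inner_gradient_eq_zero hvL hconj hφ hc, sub_zero])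
    (by
      have h1 := isBigO_folded_sub hri hre hci0 hce0 hsub hL0 hM₁0 hA hhL 1 (-1) β
      have h2 : (fun x => (P x).re - κ) =O[cocompact ℂ] (fun x => ‖x‖⁻¹) := by
        refine Asymptotics.IsBigO.trans (Asymptotics.isBigO_of_le _ fun x => ?_) h1
        rw [hκ, ← Complex.sub_re]
        exact Complex.abs_re_le_norm _
      refine (hu.decay.sub h2).congr_left fun x => ?_
      simp only [hw]
      ring)
  rw [eLpNorm_exponent_top]
  refine eLpNormEssSup_le_of_ae_bound ?_
  filter_upwards [hzero, hPL.ae_differentiableAt] with x hx hPd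
  have hG : G x = ∇ w x := sub_eq_zero.1 hx
  have hgw : ∇ w x = ∇ (fun z => (h z).re) x + ∇ (fun z => (P z).re) x := by
    simp only [gradient, hw]
    rw [fderiv_sub_const, fderiv_fun_add (hre1.differentiable one_ne_zero x) hPd, map_add]
  rw [hG, hgw, add_sub_cancel_left, norm_gradient]
  refine (norm_fderiv_le_of_lipschitz ℝ hPL).trans (le_of_eq ?_)
  exact Real.coe_toNNReal _ (by positivity)

end CoreShell

theorem mainTheorem2 :
    (∀ k_i k_e : ℝ, 0 < k_i → 0 < k_e →
      (1 / 4 < CoreShell.lambdaI k_i k_e * CoreShell.lambdaE k_e ↔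
        (k_e < k_i ∧ 1 < k_e) ∨ (k_i < k_e ∧ k_e < 1))) ∧
    ∀ r_i r_e : ℝ, 0 < r_i → r_i < r_e →
      ∀ H : ℂ → ℝ, InnerProductSpace.HarmonicOnNhd H Set.univ →
      ∀ ε₀ : ℝ, ε₀ < r_e - r_i →
      ∃ C : ℝ, 0 < C ∧
        ∀ ε : ℝ, 0 < ε → ε ≤ ε₀ →
        ∀ k_i k_e : ℝ, 0 < k_i → 0 < k_e →
          1 / 4 < CoreShell.lambdaI k_i k_e * CoreShell.lambdaE k_e →
        ∀ (u : ℂ → ℝ) (G : ℂ → ℂ),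
          CoreShell.IsSolution (CoreShell.conductivity r_i r_e ε k_i k_e) H u G →
          eLpNorm (fun x => G x - ∇ H x) ∞ volume ≤ ENNReal.ofReal C := by
  refine ⟨fun k_i k_e hki hke => CoreShell.quarter_lt_lambda_mul_lambda_iff hki hke, ?_⟩
  intro r_i r_e hri hrie H hH ε₀ hε₀
  obtain ⟨h, hh, rfl⟩ := hH.exists_analyticOnNhd_univ_re_eq
  have hd : Differentiable ℂ h := fun z => (hh z (Set.mem_univ z)).differentiableAt
  set c : ℝ := r_e ^ 2 / (2 * (r_e - r_i - ε₀)) + r_e with hc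
  obtain ⟨M₁, hM₁⟩ := (isCompact_closedBall (0 : ℂ) (2 * c)).exists_bound_of_continuousOn
    hd.deriv.continuous.continuousOn
  obtain ⟨M₂, hM₂⟩ := (isCompact_closedBall (0 : ℂ) (2 * c)).exists_bound_of_continuousOn
    hd.deriv.deriv.continuous.continuousOn
  refine ⟨max (2 * (2 * (116 * M₁ + 216 * M₂ * c)) + M₁) 1, by positivity, ?_⟩
  intro ε hε hεε₀ k_i k_e hki hke hk u G hu
  refine (CoreShell.eLpNorm_sub_gradient_le hri hε (hεε₀.trans_lt hε₀) hki hke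
    ((CoreShell.quarter_lt_lambda_mul_lambda_iff hki hke).1 hk) hd
    (CoreShell.shellCenter_le hri hε hεε₀ hε₀) hM₁ hM₂ hu).trans ?_
  exact ENNReal.ofReal_le_ofReal (le_max_left _ _)
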